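/- **Setting.** Let $\mathbb X,\mathbb Y$ be countable alphabets with all subsets measurable, and let $\Omega_X\subset\mathbb X^{\mathbb Z}$, $\Omega_Y\subset\mathbb Y^{\mathbb Z}$ be measurable and shift-invariant ($T_X^{-1}\Omega_X=\Omega_X$, $T_Y^{-1}\Omega_Y=\Omega_Y$ for the shifts $(Tz)_i=z_{i+1}$), with the restricted product $\sigma$-fields $\mathcal J_X,\mathcal J_Y$ and the invariant $\sigma$-fields $\mathcal I_Z=\{C\in\mathcal J_Z: T_Z^{-1}C=C\}$, $Z\in\{X,Y\}$. A probability measure $P$ on $(\Omega_Z,\mathcal J_Z)$ is *asymptotically mean stationary* (AMS) if $\bar P(C)=\lim_{n\to\infty}\frac1n\sum_{i=0}^{n-1}P(T_Z^{-i}C)$ exists for every $C\in\mathcal J_Z$; the measure $\bar P$ is its *stationary mean*. $\bar P(\cdot|\mathcal I_Z)$ denotes the regular conditional measure. For measurable $g:\Omega_X\to\Omega_Y$ the *quasi-period* is $L_g(x)=\inf\{l\ge1: T_Y^l g(x)=g(T_Xx)\}$ ($\inf\emptyset=\infty$), and the *spread* is $G_g(B)(x)=\sum_{l=0}^{L_g(x)-1}\mathbf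 1\{T_Y^l g(x)\in B\}$. The map $g$ is a *self-avoiding code* if (a) $L_g(x)<\infty$ for all $x$; (b) $g$ is injective, and for all $a,b\in\Omega_X$, $T_X^ja=b$ for some $j\in\mathbb Z$ if and only if $T_Y^ig(a)=g(b)$ for some $i\in\mathbb Z$; (c) for all $x\in\Omega_X$ and $j\in\mathbb Z$, $T_Y^jg(x)\in g(\Omega_X)$ implies $j\le0$ or $j\ge L_g(x)$. Let $\mathbb A_X^g$ be the set of AMS probability measures $P_X$ on $\Omega_X$ with $\int L_g\,d\bar P_X(\cdot|\mathcal I_X)<\infty$ $P_X$-a.s., and $\mathbb A_Y^g$ the set of AMS probability measures $P_Y$ on $\Omega_Y$ with $\bar P_Y(g(\Omega_X)|\mathcal I_Y)>0$ $P_Y$-a.s. For measures $f$ on $\Omega_X$ and $h$ on $\Omega_Y$ put $$C_g(f)(B)=\frac{\int G_g(B)\,df}{\int L_g\,df},\qquad C_g^{-1}(h)(A)=\frac{h(g(A))}{h(g(\Omega_X))}.$$ **Theorem.** Let $g:\Omega_X\to\Omega_Y$ be a self-avoiding code, and let $P_X$, $P_Y$ be measures on $\Omega_X$, $\Omega_Y$.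 1. $P_X\in\mathbb A_X^g$ and $P_Y(B)=P_X(g^{-1}(B))$ for all $B\in\mathcal J_Y$ if and only if $P_Y\in\mathbb A_Y^g$, $P_X(A)=P_Y(g(A))$ for all $A\in\mathcal J_X$, and $P_Y(g(\Omega_X))=1$. 2. Suppose the conditions in 1 hold, and let $\nu_X$, $\nu_Y$ be the priors of the ergodic decompositions of $\bar P_X$, $\bar P_Y$, that is, the laws of the random measures $\bar P_X(\cdot|\mathcal I_X)$ under $\bar P_X$ and $\bar P_Y(\cdot|\mathcal I_Y)$ under $\bar P_Y$. Then $\nu_Y$ is the image of $\nu_X$ under $C_g$, $\nu_X$ is the image of $\nu_Y$ under $C_g^{-1}$, and for all $B\in\mathcal J_Y$ and $A\in\mathcal J_X$ $$\bar P_Y(B)=\int f_Y(B)\,d\nu_Y(f_Y)=\int C_g(f_X)(B)\,d\nu_X(f_X)=\int\frac{\int G_g(B)\,df_X}{\int L_g\,df_X}\,d\nu_X(f_X)=\int\frac{\int G_g(B)\,d\bar P_X(\cdot|\mathcal I_X)}{\int L_g\,d\bar P_X(\cdot|\mathcal I_X)}\,d\bar P_X,$$ $$\bar P_X(A)=\int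 f_X(A)\,d\nu_X(f_X)=\int C_g^{-1}(f_Y)(A)\,d\nu_Y(f_Y)=\int\frac{f_Y(g(A))}{f_Y(g(\Omega_X))}\,d\nu_Y(f_Y)=\int\frac{\bar P_Y(g(A)|\mathcal I_Y)}{\bar P_Y(g(\Omega_X)|\mathcal I_Y)}\,d\bar P_Y.$$ -/

import Mathlib

open MeasureTheory ProbabilityTheory Filter Topology
open scoped ENNReal

/-- The shift on two-sided sequences, `(T x)_i = x_{i+1}`, as a bijection. -/
def fullShift (X : Type*) : Equiv.Perm (ℤ → X) where
  toFun x i := x (i + 1)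
  invFun x i := x (i - 1)
  left_inv x := by funext i; simp
  right_inv x := by funext i; simp

/-- A measurable shift-invariant set `Ω` of two-sided sequences over the alphabet `X`. Coerced to a
type, it carries the restriction to `Ω` of the product `σ`-field. -/
structure InvariantSet (X : Type*) [MeasurableSpace X] where
  carrier : Set (ℤ → X)
  measurableSet_carrier : MeasurableSet carrier
  shift_preimage : fullShift X ⁻¹' carrier = carrier

instance {X : Type*} [MeasurableSpace X] : CoeSort (InvariantSet X) (Type _) :=
  ⟨fun Ω => Ω.carrier⟩

instance {X : Type*} [Countable X] [MeasurableSpace X] [MeasurableSingletonClass X]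
    (Ω : InvariantSet X) : StandardBorelSpace Ω :=
  Ω.measurableSet_carrier.standardBorel

/-- The shift `T` restricted to `Ω`; `T ^ j` is its `j`-th iterate, also for negative `j`. -/
def shift {X : Type*} [MeasurableSpace X] (Ω : InvariantSet X) : Equiv.Perm Ω :=
  (fullShift X).subtypePerm fun x => by
    change x ∈ fullShift X ⁻¹' Ω.carrier ↔ x ∈ Ω.carrier
    rw [Ω.shift_preimage]

/-- The invariant `σ`-field: measurable sets `A` with `T⁻¹ A = A`. -/
abbrev invField {X : Type*} [MeasurableSpace X] (Ω : InvariantSet X) : MeasurableSpace Ω :=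
  MeasurableSpace.invariants (shift Ω)

/-- The averages `(1/n) ∑_{i<n} P(T^{-i} C)`. -/
noncomputable def cesaro {X : Type*} [MeasurableSpace X] {Ω : InvariantSet X} (P : Measure Ω)
    (C : Set Ω) (n : ℕ) : ℝ≥0∞ :=
  (∑ i ∈ Finset.range n, P (⇑(shift Ω ^ i) ⁻¹' C)) / n

/-- `P` is an asymptotically mean stationary probability measure. -/
def IsAMS {X : Type*} [MeasurableSpace X] {Ω : InvariantSet X} (P : Measure Ω) : Prop :=
  IsProbabilityMeasure P ∧
    ∀ C : Set Ω, MeasurableSet C → ∃ c : ℝ≥0∞, Tendsto (cesaro P C) atTop (𝓝 c)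

open Classical in
/-- The stationary mean of `P`: the measure whose value at every measurable `C` is the limit of
`cesaro P C`. It is unique, it exists for every AMS `P` (setwise limits of probability measures
are probability measures), and it is set to `0` if there is none. -/
noncomputable def stationaryMean {X : Type*} [MeasurableSpace X] {Ω : InvariantSet X}
    (P : Measure Ω) : Measure Ω :=
  if h : ∃ Q : ProbabilityMeasure Ω, ∀ C : Set Ω, MeasurableSet C →
      Tendsto (cesaro P C) atTop (𝓝 ((Q : Measure Ω) C))
  then (h.choose : Measure Ω) else 0

instance {X : Type*} [MeasurableSpace X] {Ω : InvariantSet X} (P : Measure Ω) :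
    IsFiniteMeasure (stationaryMean P) := by
  unfold stationaryMean
  split_ifs <;> infer_instance

/-- The regular conditional measure `P(·|I)(x)` given the invariant `σ`-field. -/
noncomputable def condInv {X : Type*} [Countable X] [MeasurableSpace X]
    [MeasurableSingletonClass X] {Ω : InvariantSet X} (P : Measure Ω) [IsFiniteMeasure P]
    (x : Ω) : Measure Ω :=
  condExpKernel P (invField Ω) x

/-- The prior `ν` of the ergodic decomposition of `P`: the law of `P(·|I)` under `P`. -/
noncomputable def prior {X : Type*} [Countable X] [MeasurableSpace X]
    [MeasurableSingletonClass X] {Ω : InvariantSet X} (P : Measure Ω) [IsFiniteMeasure P] :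
    Measure (Measure Ω) :=
  P.map (condInv P)

section Codes

variable {X Y : Type*} [MeasurableSpace X] [MeasurableSpace Y]
  {ΩX : InvariantSet X} {ΩY : InvariantSet Y}

/-- The quasi-period `L_g(x) = inf {l ≥ 1 : T^l g(x) = g(T x)}`, with `inf ∅ = ∞`. -/
noncomputable def quasiPeriod (g : ΩX → ΩY) (x : ΩX) : ℕ∞ :=
  sInf {m : ℕ∞ | ∃ l : ℕ, m = l ∧ 1 ≤ l ∧ (shift ΩY ^ l) (g x) = g (shift ΩX x)}

def IsQuasiPeriodic (g : ΩX → ΩY) : Prop :=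
  Measurable g ∧ ∀ x, quasiPeriod g x < ⊤

def IsSynchronizable (g : ΩX → ΩY) : Prop :=
  Measurable g ∧ Function.Injective g ∧
    ∀ a b : ΩX, (∃ j : ℤ, (shift ΩX ^ j) a = b) ↔ (∃ i : ℤ, (shift ΩY ^ i) (g a) = g b)

/-- Self-avoiding codes. The quasi-period is finite here, so that `toNat` is its value. -/
def IsSelfAvoiding (g : ΩX → ΩY) : Prop :=
  IsSynchronizable g ∧ IsQuasiPeriodic g ∧
    ∀ (x : ΩX) (j : ℤ), (shift ΩY ^ j) (g x) ∈ Set.range g →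
      j ≤ 0 ∨ ((quasiPeriod g x).toNat : ℤ) ≤ j

/-- The quasi-period as an extended nonnegative real, for integration. -/
noncomputable def qpLength (g : ΩX → ΩY) (x : ΩX) : ℝ≥0∞ :=
  (quasiPeriod g x : ℝ≥0∞)

/-- The spread `G_g(B)(x) = ∑_{0 ≤ l < L_g(x)} 1{T^l g(x) ∈ B}`. -/
noncomputable def spread (g : ΩX → ΩY) (B : Set ΩY) (x : ΩX) : ℝ≥0∞ :=
  ∑ l ∈ Finset.range (quasiPeriod g x).toNat, B.indicator 1 ((shift ΩY ^ l) (g x))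

/-- The measure `C_g(f) : B ↦ ∫ G_g(B) df / ∫ L_g df`; the map `x ↦ ∑_{l < L_g(x)} δ_{T^l g(x)}`
that is integrated against `f` has the value `G_g(B)(x)` at `B`. -/
noncomputable def normTransport (g : ΩX → ΩY) (f : Measure ΩX) : Measure ΩY :=
  (∫⁻ x, qpLength g x ∂f)⁻¹ • f.bind fun x =>
    ∑ l ∈ Finset.range (quasiPeriod g x).toNat, Measure.dirac ((shift ΩY ^ l) (g x))

/-- The measure `C_g⁻¹(f) : A ↦ f(g(A)) / f(g(Ω_X))`. -/
noncomputable def normTransportInv (g : ΩX → ΩY) (f : Measure ΩY) : Measure ΩX :=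
  (f (Set.range g))⁻¹ • f.comap g

/-- The class `𝔸_X^g`. -/
def AMSSource [Countable X] [MeasurableSingletonClass X] (g : ΩX → ΩY) : Set (Measure ΩX) :=
  {P | IsAMS P ∧ ∀ᵐ x ∂P, ∫⁻ x', qpLength g x' ∂(condInv (stationaryMean P) x) < ∞}

/-- The class `𝔸_Y^g`. -/
def AMSTarget [Countable Y] [MeasurableSingletonClass Y] (g : ΩX → ΩY) : Set (Measure ΩY) :=
  {P | IsAMS P ∧ ∀ᵐ y ∂P, 0 < condInv (stationaryMean P) y (Set.range g)}

/-- The plain transport `P_Y = P_X ∘ g⁻¹`. -/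
def PlainTransport (g : ΩX → ΩY) (PX : Measure ΩX) (PY : Measure ΩY) : Prop :=
  ∀ B : Set ΩY, MeasurableSet B → PY B = PX (g ⁻¹' B)

/-- The plain transport in the opposite direction, `P_X = P_Y ∘ g`. -/
def PlainTransportInv (g : ΩX → ΩY) (PX : Measure ΩX) (PY : Measure ΩY) : Prop :=
  ∀ A : Set ΩX, MeasurableSet A → PX A = PY (g '' A)

end Codes

/-! Let Q be the stationary mean of P_X. Replace each x by its block of points T^l g(x), l < L_g(x),
and integrate these blocks against Q weighted by the invariant density 1/∫L_g dQ(·|I). The resulting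
measure R on Ω_Y (`stationaryTransport`) is stationary, because shifting a block only trades its
first point g(x) for g(Tx) (`spread_preimage_shift`). The weight normalizes each conditional
contribution to C_g(Q(·|I)), a probability, so R agrees with P_X ∘ g⁻¹ on invariant events.

A stationary measure that agrees with P on the invariant σ-field is the stationary mean of P
(`stationaryMean_eq_of_agreeOnInvariant`). It dominates P, since the saturation of a null set is
invariant and null, and the mean ergodic theorem evaluates the averages of every measure it
dominates. Hence R is the stationary mean of P_Y.

Orbits correspond under g, so the invariant events of the source are exactly the preimages of those
of the target. Consequently the conditional measure at g(x) is C_g of the one at x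
(`condInv_stationaryMean_map_ae_eq`), which links the priors. C_g⁻¹ undoes C_g because a block meets
g(Ω_X) only in its first point, and the integral formulas are changes of variables.

For the converse in part 1, the stationary mean of P_Y is pulled back along g. The pullback is
stationary and dominates P_X, and Kac's inequality bounds its integral of L_g (`mem_AMSSource`). -/

/-! ### Setwise limits of probability measures. -/

section SetwiseLimits

variable {α : Type*} [MeasurableSpace α]

/-- The union of the sets `B k` selected by `K`. -/
def selectedUnion (B : ℕ → Set α) (K : ℕ → Bool) : Set α := ⋃ k ∈ {k | K k = true}, B k

theorem measurableSet_selectedUnion {B : ℕ → Set α} (hB : ∀ k, MeasurableSet (B k))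
    (K : ℕ → Bool) : MeasurableSet (selectedUnion B K) :=
  MeasurableSet.biUnion (Set.to_countable _) fun k _ => hB k

theorem hasSum_measureReal_selectedUnion (P : Measure α) [IsFiniteMeasure P] {B : ℕ → Set α}
    (hB : ∀ k, MeasurableSet (B k)) (hd : Pairwise (Function.onFun Disjoint B)) (K : ℕ → Bool) :
    HasSum (fun k => if K k = true then P.real (B k) else 0) (P.real (selectedUnion B K)) := by
  have hs : selectedUnion B K = ⋃ k, (if K k = true then B k else ∅) := by
    ext x
    simp only [selectedUnion, Set.mem_ofPred_eq, Set.mem_iUnion, exists_prop]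
    refine exists_congr fun k => ?_
    by_cases h : K k = true <;> simp [h]
  have hd' : Pairwise (Function.onFun Disjoint fun k => (if K k = true then B k else ∅)) := by
    intro i j hij
    simp only [Function.onFun]
    split_ifs
    · exact hd hij
    all_goals simp
  have hm : ∀ k, MeasurableSet (if K k = true then B k else ∅) := by
    intro k
    split_ifs
    · exact hB k
    · exact MeasurableSet.empty
  rw [hs]
  have h1 : ∑' k, P (if K k = true then B k else ∅) ≠ ∞ := by
    rw [← measure_iUnion hd' hm]
    exact measure_ne_top _ _
  have h2 := (ENNReal.summable_toReal h1).hasSum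
  rw [← ENNReal.tsum_toReal_eq fun k => measure_ne_top _ _, ← measure_iUnion hd' hm] at h2
  rw [measureReal_def]
  convert h2 using 2 with k
  split_ifs <;> simp [Measure.real]

/-- Weierstrass M-test: each summand depends on one coordinate and is dominated by a summable
sequence independent of `K`. Continuity on Cantor space is what allows a Baire category argument. -/
theorem continuous_measureReal_selectedUnion (P : Measure α) [IsFiniteMeasure P] {B : ℕ → Set α}
    (hB : ∀ k, MeasurableSet (B k)) (hd : Pairwise (Function.onFun Disjoint B)) :
    Continuous fun K => P.real (selectedUnion B K) := by
  have h1 : (fun K => P.real (selectedUnion B K)) =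
      fun K : ℕ → Bool => ∑' k, if K k = true then P.real (B k) else 0 :=
    funext fun K => (hasSum_measureReal_selectedUnion P hB hd K).tsum_eq.symm
  rw [h1]
  refine continuous_tsum (u := fun k => P.real (B k)) (fun k => ?_) ?_ fun k K => ?_
  · exact (continuous_of_discreteTopology (f := fun b : Bool =>
      if b = true then P.real (B k) else 0)).comp (continuous_apply k)
  · simpa using (hasSum_measureReal_selectedUnion P hB hd fun _ => true).summable
  · split_ifs <;> simp [abs_of_nonneg]

/-- A gliding-hump principle: along a setwise convergent sequence of finite measures, the tails of
a disjoint sequence of sets have uniformly small measure. -/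
theorem exists_uniformly_small_tail (P : ℕ → Measure α) [∀ n, IsFiniteMeasure (P n)]
    (h : ∀ C, MeasurableSet C → ∃ c : ℝ, Tendsto (fun n => (P n).real C) atTop (𝓝 c))
    {B : ℕ → Set α} (hB : ∀ k, MeasurableSet (B k)) (hd : Pairwise (Function.onFun Disjoint B))
    {ε : ℝ} (hε : 0 < ε) :
    ∃ M N : ℕ, ∀ m ≥ M, ∀ n ≥ N, (P n).real (⋃ k ∈ {k | m ≤ k}, B k) ≤ ε := by
  -- `F N` collects the selections along which the sequence has settled from `N` on. These closed
  -- sets cover the compact space of selections, so by Baire one of them has interior.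
  set F : ℕ → Set (ℕ → Bool) := fun N => ⋂ n : ℕ, {K | N ≤ n →
    |(P n).real (selectedUnion B K) - (P N).real (selectedUnion B K)| ≤ ε / 4}
  have hF : ∀ N, IsClosed (F N) := fun N => by
    refine isClosed_iInter fun n => ?_
    by_cases hn : N ≤ n
    · simp only [hn, true_imp_iff]
      exact isClosed_le (((continuous_measureReal_selectedUnion (P n) hB hd).sub
        (continuous_measureReal_selectedUnion (P N) hB hd)).abs) continuous_const
    · simp [hn]
  have hU : ⋃ N, F N = Set.univ := by
    refine Set.eq_univ_of_forall fun K => ?_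
    obtain ⟨c, hc⟩ := h _ (measurableSet_selectedUnion hB K)
    obtain ⟨N, hN⟩ := Metric.tendsto_atTop.1 hc (ε / 8) (by positivity)
    refine Set.mem_iUnion.2 ⟨N, Set.mem_iInter.2 fun n hn => ?_⟩
    have h1 := hN n hn
    have h2 := hN N le_rfl
    rw [Real.dist_eq] at h1 h2
    have h3 := abs_lt.1 h1
    have h4 := abs_lt.1 h2
    exact abs_le.2 ⟨by linarith, by linarith⟩
  obtain ⟨N, K₀, hK₀⟩ := nonempty_interior_of_iUnion_of_closed hF hU
  -- A basic neighbourhood restricts finitely many coordinates, so all selections that agree with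
  -- `K₀` below `M₁` lie in `F N`.
  obtain ⟨I, u, hu, hIu⟩ := isOpen_pi_iff.1 isOpen_interior K₀ hK₀
  obtain ⟨M₁, hM₁⟩ : ∃ M₁, ∀ k ∈ I, k < M₁ :=
    ⟨I.sup id + 1, fun k hk => Nat.lt_succ_of_le (Finset.le_sup (f := id) hk)⟩
  have key : ∀ K : ℕ → Bool, (∀ k < M₁, K k = K₀ k) → ∀ n ≥ N,
      |(P n).real (selectedUnion B K) - (P N).real (selectedUnion B K)| ≤ ε / 4 := by
    intro K hK n hn
    have : K ∈ F N := interior_subset (hIu (Set.mem_pi.2 fun k hk => by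
      rw [hK k (hM₁ k hk)]; exact (hu k hk).2))
    exact Set.mem_iInter.1 this n hn
  have htail : Tendsto (fun m => (P N).real (⋃ k ∈ {k | m ≤ k}, B k)) atTop (𝓝 0) := by
    have h1 : Tendsto (fun m => P N (⋃ k ∈ {k | m ≤ k}, B k)) atTop (𝓝 0) := by
      have := tendsto_measure_biUnion_Ici_zero_of_pairwise_disjoint (μ := P N)
        (fun k => (hB k).nullMeasurableSet) hd
      exact this
    exact (ENNReal.tendsto_toReal ENNReal.zero_ne_top).comp h1
  obtain ⟨M₂, hM₂⟩ := eventually_atTop.1 (htail.eventually_lt_const (show 0 < ε / 4 by positivity))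
  refine ⟨max M₁ M₂, N, fun m hm n hn => ?_⟩
  have hm₁ : M₁ ≤ m := (le_max_left _ _).trans hm
  have hm₂ := hM₂ m ((le_max_right _ _).trans hm)
  -- Both selections agree with `K₀` below `M₁` and differ exactly by the tail from `m`. Subtracting
  -- their two estimates leaves the tail, with total error at most three times `ε / 4`.
  set Kh : ℕ → Bool := fun k => if k < M₁ then K₀ k else false
  set Kt : ℕ → Bool := fun k => if k < M₁ then K₀ k else decide (m ≤ k)
  have hh := key Kh (fun k hk => by simp [Kh, hk]) n hn
  have ht := key Kt (fun k hk => by simp [Kt, hk]) n hn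
  have hsplit : selectedUnion B Kt = selectedUnion B Kh ∪ ⋃ k ∈ {k | m ≤ k}, B k := by
    ext x
    simp only [selectedUnion, Set.mem_union, Set.mem_iUnion, Set.mem_ofPred_eq, exists_prop,
      ← exists_or, ← or_and_right]
    refine exists_congr fun k => and_congr_left fun _ => ?_
    by_cases hk : k < M₁
    · have : ¬ m ≤ k := by omega
      simp [Kt, Kh, hk, this]
    · simp [Kt, Kh, hk]
  have hdisj : Disjoint (selectedUnion B Kh) (⋃ k ∈ {k | m ≤ k}, B k) := by
    simp only [selectedUnion, Set.disjoint_iUnion_left, Set.disjoint_iUnion_right]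
    intro j hj i hi
    refine hd ?_
    rintro rfl
    have hi' : Kh i = true := hi
    have hj' : m ≤ i := hj
    have : ¬ i < M₁ := by omega
    simp [Kh, this] at hi'
  have hmt : MeasurableSet (⋃ k ∈ {k | m ≤ k}, B k) :=
    MeasurableSet.biUnion (Set.to_countable _) fun k _ => hB k
  rw [hsplit, measureReal_union hdisj hmt (measure_ne_top _ _) (measure_ne_top _ _),
    measureReal_union hdisj hmt (measure_ne_top _ _) (measure_ne_top _ _)] at ht
  have h3 := abs_le.1 hh
  have h4 := abs_le.1 ht
  linarith [h3.1, h3.2, h4.1, h4.2]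

/-- The Vitali-Hahn-Saks theorem for probability measures: setwise limits are probability
measures. -/
theorem exists_probabilityMeasure_of_tendsto_setwise (P : ℕ → Measure α)
    [∀ n, IsProbabilityMeasure (P n)]
    (h : ∀ C, MeasurableSet C → ∃ c : ℝ≥0∞, Tendsto (fun n => P n C) atTop (𝓝 c)) :
    ∃ Q : ProbabilityMeasure α, ∀ C, MeasurableSet C →
      Tendsto (fun n => P n C) atTop (𝓝 ((Q : Measure α) C)) := by
  choose q hq using h
  have hle : ∀ C hC, q C hC ≤ 1 := fun C hC => le_of_tendsto' (hq C hC) fun n => prob_le_one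
  have hreal : ∀ C, MeasurableSet C → ∃ c : ℝ, Tendsto (fun n => (P n).real C) atTop (𝓝 c) :=
    fun C hC => ⟨_, (ENNReal.tendsto_toReal ((hle C hC).trans_lt ENNReal.one_lt_top).ne).comp
      (hq C hC)⟩
  have h0 : q ∅ MeasurableSet.empty = 0 := by
    refine tendsto_nhds_unique (hq ∅ _) ?_
    simp
  have hadd : ∀ ⦃f : ℕ → Set α⦄ (hf : ∀ i, MeasurableSet (f i)),
      Pairwise (Function.onFun Disjoint f) →
      q (⋃ i, f i) (MeasurableSet.iUnion hf) = ∑' i, q (f i) (hf i) := by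
    intro f hf hd
    have hfin : ∀ M, Tendsto (fun n => ∑ k ∈ Finset.range M, P n (f k)) atTop
        (𝓝 (∑ k ∈ Finset.range M, q (f k) (hf k))) :=
      fun M => tendsto_finsetSum _ fun k _ => hq _ _
    refine le_antisymm ?_ ?_
    -- The uniform tail bound is needed here: it lets the limit in `n` pass to the whole union.
    · refine ENNReal.le_of_forall_pos_le_add fun ε hε _ => ?_
      obtain ⟨M, N, hMN⟩ := exists_uniformly_small_tail P hreal hf hd (NNReal.coe_pos.2 hε)
      have h1 : q (⋃ i, f i) (MeasurableSet.iUnion hf) ≤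
          ∑ k ∈ Finset.range M, q (f k) (hf k) + ε := by
        refine le_of_tendsto_of_tendsto (hq _ _) ((hfin M).add_const _) ?_
        filter_upwards [eventually_ge_atTop N] with n hn
        have h2 : ⋃ i, f i ⊆ (⋃ k ∈ Finset.range M, f k) ∪ ⋃ k ∈ {k | M ≤ k}, f k := by
          intro x hx
          obtain ⟨k, hk⟩ := Set.mem_iUnion.1 hx
          by_cases hkM : k < M
          · exact Or.inl (Set.mem_biUnion (Finset.mem_range.2 hkM) hk)
          · exact Or.inr (Set.mem_biUnion (show M ≤ k by omega) hk)
        refine (measure_mono h2).trans ((measure_union_le _ _).trans ?_)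
        refine add_le_add (measure_biUnion_finset_le _ _) ?_
        have h3 := hMN M le_rfl n hn
        rw [← ofReal_measureReal (measure_ne_top _ _)]
        exact (ENNReal.ofReal_le_ofReal h3).trans (by simp)
      exact h1.trans (add_le_add (ENNReal.sum_le_tsum _) le_rfl)
    · refine ENNReal.tsum_le_of_sum_range_le fun M => ?_
      refine le_of_tendsto_of_tendsto' (hfin M) (hq _ (MeasurableSet.iUnion hf)) fun n => ?_
      rw [← measure_biUnion_finset (fun i _ j _ hij => hd hij) fun k _ => hf k]
      exact measure_mono (Set.iUnion₂_subset fun k _ => Set.subset_iUnion f k)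
  set Q : Measure α := Measure.ofMeasurable q h0 hadd
  have hQ : ∀ C (hC : MeasurableSet C), Q C = q C hC := fun C hC => Measure.ofMeasurable_apply C hC
  have hQp : IsProbabilityMeasure Q := ⟨by
    rw [hQ _ MeasurableSet.univ]
    refine tendsto_nhds_unique (hq _ _) ?_
    simp⟩
  exact ⟨⟨Q, hQp⟩, fun C hC => by simpa [hQ C hC] using hq C hC⟩

end SetwiseLimits

/-! ### Invariant events and saturations. -/

section Shift

variable {X : Type*} [MeasurableSpace X] {Ω : InvariantSet X}

theorem measurable_shift : Measurable (shift Ω) := by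
  refine Measurable.subtype_mk ?_
  refine measurable_pi_lambda _ fun i => ?_
  exact (measurable_pi_apply (i + 1)).comp measurable_subtype_coe

theorem measurable_shift_symm : Measurable (shift Ω).symm := by
  refine Measurable.subtype_mk ?_
  refine measurable_pi_lambda _ fun i => ?_
  exact (measurable_pi_apply (i - 1)).comp measurable_subtype_coe

theorem measurable_shift_pow (n : ℕ) : Measurable ⇑(shift Ω ^ n) := by
  rw [← Equiv.Perm.iterate_eq_pow]
  exact measurable_shift.iterate n

theorem measurable_shift_zpow (j : ℤ) : Measurable ⇑(shift Ω ^ j) := by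
  cases j with
  | ofNat n => simpa using measurable_shift_pow n
  | negSucc n =>
    rw [zpow_negSucc, ← inv_pow, ← Equiv.Perm.iterate_eq_pow]
    exact measurable_shift_symm.iterate _

theorem invField_le : invField Ω ≤ (inferInstance : MeasurableSpace Ω) :=
  MeasurableSpace.invariants_le _

theorem apply_shift_zpow_of_invariant {β : Type*} {F : Ω → β} (hF : ∀ x, F (shift Ω x) = F x)
    (j : ℤ) (x : Ω) : F ((shift Ω ^ j) x) = F x := by
  induction j with
  | zero => simp
  | succ n ih => rw [add_comm, zpow_add, zpow_one, Equiv.Perm.mul_apply, hF, ih]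
  | pred n ih =>
    rw [← ih, ← hF ((shift Ω ^ (-(n : ℤ) - 1)) x), ← Equiv.Perm.mul_apply, ← zpow_one_add]
    congr 3
    ring

theorem mem_shift_zpow_iff {D : Set Ω} (hD : MeasurableSet[invField Ω] D) (j : ℤ) (x : Ω) :
    (shift Ω ^ j) x ∈ D ↔ x ∈ D :=
  iff_of_eq (apply_shift_zpow_of_invariant (F := fun y => y ∈ D)
    (fun y => (congrArg (fun E : Set Ω => y ∈ E) hD.2 : (y ∈ shift Ω ⁻¹' D) = _)) j x)

theorem apply_shift_of_measurable_invField {F : Ω → ℝ≥0∞} (hF : Measurable[invField Ω] F)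
    (x : Ω) : F (shift Ω x) = F x :=
  congrFun (MeasurableSpace.comp_eq_of_measurable_invariants hF) x

theorem measurable_invField_of_invariant {β : Type*} [MeasurableSpace β] {F : Ω → β}
    (hF : Measurable F) (hinv : ∀ x, F (shift Ω x) = F x) : Measurable[invField Ω] F :=
  MeasurableSpace.measurable_invariants_dom.2 ⟨hF, fun s _ => by
    rw [show F ∘ shift Ω = F from funext hinv]⟩

/-- The smallest invariant set that contains `A`. -/
def saturation (A : Set Ω) : Set Ω := ⋃ j : ℤ, ⇑(shift Ω ^ j) ⁻¹' A

theorem mem_saturation {A : Set Ω} {x : Ω} : x ∈ saturation A ↔ ∃ j : ℤ, (shift Ω ^ j) x ∈ A := by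
  simp [saturation]

theorem measurableSet_saturation {A : Set Ω} (hA : MeasurableSet A) :
    MeasurableSet[invField Ω] (saturation A) := by
  refine ⟨MeasurableSet.iUnion fun j => measurable_shift_zpow j hA, ?_⟩
  ext x
  rw [Set.mem_preimage, mem_saturation, mem_saturation]
  constructor
  · rintro ⟨j, hj⟩
    exact ⟨j + 1, by rwa [zpow_add_one, Equiv.Perm.mul_apply]⟩
  · rintro ⟨j, hj⟩
    refine ⟨j - 1, ?_⟩
    rwa [← Equiv.Perm.mul_apply, ← zpow_add_one, sub_add_cancel]

theorem measure_preimage_shift_zpow {Q : Measure Ω} (hQ : MeasurePreserving (shift Ω) Q Q)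
    (j : ℤ) {A : Set Ω} (hA : MeasurableSet A) : Q (⇑(shift Ω ^ j) ⁻¹' A) = Q A := by
  have hpow : ∀ (n : ℕ) {A : Set Ω}, MeasurableSet A → Q (⇑(shift Ω ^ n) ⁻¹' A) = Q A := by
    intro n A hA
    rw [← Equiv.Perm.iterate_eq_pow]
    exact (hQ.iterate n).measure_preimage hA.nullMeasurableSet
  cases j with
  | ofNat n => simpa using hpow n hA
  | negSucc n =>
    rw [← hpow (n + 1) (measurable_shift_zpow (Int.negSucc n) hA), ← Set.preimage_comp,
      ← Equiv.Perm.coe_mul, zpow_negSucc, inv_mul_cancel]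
    rfl

theorem measure_saturation_eq_zero {Q : Measure Ω} (hQ : MeasurePreserving (shift Ω) Q Q)
    {A : Set Ω} (hA : MeasurableSet A) (h : Q A = 0) : Q (saturation A) = 0 :=
  measure_iUnion_null fun j => (measure_preimage_shift_zpow hQ j hA).trans h

/-- Two measures agree on the invariant `σ`-field. -/
def AgreeOnInvariant (P Q : Measure Ω) : Prop :=
  ∀ D, MeasurableSet[invField Ω] D → P D = Q D

theorem AgreeOnInvariant.lintegral_eq {P Q : Measure Ω} (h : AgreeOnInvariant P Q)
    {F : Ω → ℝ≥0∞} (hF : Measurable[invField Ω] F) : ∫⁻ x, F x ∂P = ∫⁻ x, F x ∂Q := by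
  rw [← lintegral_trim invField_le hF, ← lintegral_trim invField_le hF]
  congr 1
  refine @Measure.ext _ (invField Ω) _ _ fun D hD => ?_
  rw [trim_measurableSet_eq invField_le hD, trim_measurableSet_eq invField_le hD, h D hD]

theorem AgreeOnInvariant.ae_iff {P Q : Measure Ω} (h : AgreeOnInvariant P Q) {p : Ω → Prop}
    (hp : MeasurableSet[invField Ω] {x | p x}) : (∀ᵐ x ∂P, p x) ↔ ∀ᵐ x ∂Q, p x := by
  have := h _ (@MeasurableSet.compl _ _ (invField Ω) hp)
  exact iff_of_eq (congrArg (· = 0) this)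

/-- The saturation of a `Q`-null set is a countable union of `Q`-null translates and is invariant,
hence also `P`-null. -/
theorem absolutelyContinuous_of_agreeOnInvariant {P Q : Measure Ω}
    (hQ : MeasurePreserving (shift Ω) Q Q) (h : AgreeOnInvariant P Q) : P ≪ Q := by
  refine Measure.AbsolutelyContinuous.mk fun A hA hA0 => measure_mono_null (t := saturation A)
    (fun x hx => mem_saturation.2 ⟨0, by simpa using hx⟩) ?_
  rw [h _ (measurableSet_saturation hA), measure_saturation_eq_zero hQ hA hA0]

end Shift

/-! ### Existence and invariance of the stationary mean. -/

section StationaryMean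

variable {X : Type*} [MeasurableSpace X] {Ω : InvariantSet X}

theorem exists_tendsto_cesaro {P : Measure Ω} (hP : IsAMS P) :
    ∃ Q : ProbabilityMeasure Ω, ∀ C : Set Ω, MeasurableSet C →
      Tendsto (cesaro P C) atTop (𝓝 ((Q : Measure Ω) C)) := by
  have := hP.1
  -- The index is moved by one because the empty average is `0 / 0 = 0`, not a probability.
  set R : ℕ → Measure Ω := fun n => ((n + 1 : ℕ) : ℝ≥0∞)⁻¹ •
    ∑ i ∈ Finset.range (n + 1), P.map ⇑(shift Ω ^ i)
  have hR : ∀ n C, MeasurableSet C → R n C = cesaro P C (n + 1) := by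
    intro n C hC
    simp only [R, cesaro, Measure.smul_apply, Measure.finsetSum_apply, smul_eq_mul,
      Measure.map_apply (measurable_shift_pow _) hC]
    rw [mul_comm, div_eq_mul_inv]
  have hRp : ∀ n, IsProbabilityMeasure (R n) := fun n => ⟨by
    rw [hR n _ MeasurableSet.univ]
    simp only [cesaro, Set.preimage_univ, measure_univ, Finset.sum_const, Finset.card_range,
      nsmul_eq_mul, mul_one]
    exact ENNReal.div_self (by simp) (ENNReal.natCast_ne_top _)⟩
  obtain ⟨Q, hQ⟩ := exists_probabilityMeasure_of_tendsto_setwise R fun C hC => by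
    obtain ⟨c, hc⟩ := hP.2 C hC
    exact ⟨c, (hc.comp (tendsto_add_atTop_nat 1)).congr fun n => (hR n C hC).symm⟩
  refine ⟨Q, fun C hC => (tendsto_add_atTop_iff_nat 1).1 ?_⟩
  simpa only [hR _ C hC] using hQ C hC

theorem tendsto_cesaro_stationaryMean {P : Measure Ω} (hP : IsAMS P) {C : Set Ω}
    (hC : MeasurableSet C) : Tendsto (cesaro P C) atTop (𝓝 (stationaryMean P C)) := by
  have h := exists_tendsto_cesaro hP
  rw [stationaryMean, dif_pos h]
  exact h.choose_spec C hC

theorem isProbabilityMeasure_stationaryMean {P : Measure Ω} (hP : IsAMS P) :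
    IsProbabilityMeasure (stationaryMean P) := by
  have h := exists_tendsto_cesaro hP
  rw [stationaryMean, dif_pos h]
  infer_instance

theorem agreeOnInvariant_stationaryMean {P : Measure Ω} (hP : IsAMS P) :
    AgreeOnInvariant P (stationaryMean P) := by
  intro D hD
  refine tendsto_nhds_unique ?_ (tendsto_cesaro_stationaryMean hP hD.1)
  refine tendsto_const_nhds.congr' ?_
  filter_upwards [eventually_ge_atTop 1] with n hn
  have : ∀ i : ℕ, ⇑(shift Ω ^ i) ⁻¹' D = D := fun i => by
    ext x
    simpa using mem_shift_zpow_iff hD i x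
  simp only [cesaro, this, Finset.sum_const, Finset.card_range, nsmul_eq_mul]
  rw [mul_comm, ENNReal.mul_div_cancel_right (by simp; omega) (ENNReal.natCast_ne_top _)]

/-- The averages of `C` and of its preimage differ by two boundary terms over `n`. Each is added to
the opposite side, which avoids truncated subtraction. -/
theorem measurePreserving_stationaryMean {P : Measure Ω} (hP : IsAMS P) :
    MeasurePreserving (shift Ω) (stationaryMean P) (stationaryMean P) := by
  have := hP.1
  refine ⟨measurable_shift, Measure.ext fun C hC => ?_⟩
  rw [Measure.map_apply measurable_shift hC]
  have h0 : ∀ u : ℕ → ℝ≥0∞, (∀ n, u n ≤ 1) → Tendsto (fun n : ℕ => u n / n) atTop (𝓝 0) := by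
    intro u hu
    refine tendsto_of_tendsto_of_tendsto_of_le_of_le tendsto_const_nhds
      (ENNReal.tendsto_inv_nat_nhds_zero) (fun n => zero_le) fun n => ?_
    simpa [div_eq_mul_inv] using mul_le_mul_left (hu n) ((n : ℝ≥0∞)⁻¹)
  have h1 := (tendsto_cesaro_stationaryMean hP (measurable_shift hC)).add
    (h0 (fun _ => P C) fun _ => prob_le_one)
  have h2 := (tendsto_cesaro_stationaryMean hP hC).add
    (h0 (fun n => P (⇑(shift Ω ^ n) ⁻¹' C)) fun _ => prob_le_one)
  rw [add_zero] at h1 h2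
  refine tendsto_nhds_unique h1 (h2.congr fun n => ?_)
  simp only [cesaro]
  rw [← ENNReal.add_div, ← ENNReal.add_div, ← Finset.sum_range_succ
    (fun i => P (⇑(shift Ω ^ i) ⁻¹' C)), Finset.sum_range_succ']
  congr 2
  refine Finset.sum_congr rfl fun i _ => ?_
  rw [← Set.preimage_comp, ← Equiv.Perm.coe_mul, ← pow_succ']

end StationaryMean

/-! ### Uniqueness of conditional measures. -/

section Disintegration

variable {α β : Type*} [MeasurableSpace β] [MeasurableSpace.CountablyGenerated β]

/-- Two families of probability measures that are measurable with respect to a sub-`σ`-field `m`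
agree almost surely if their integrals agree over the sets of `m`. -/
theorem ae_eq_of_forall_setLIntegral_apply_eq {m mα : MeasurableSpace α} (hm : m ≤ mα)
    {Q : Measure[mα] α} [IsFiniteMeasure Q] {κ η : α → Measure β}
    (hκp : ∀ x, IsProbabilityMeasure (κ x)) (hηp : ∀ᵐ x ∂Q, IsProbabilityMeasure (η x))
    (hκ : ∀ C, MeasurableSet C → Measurable[m] fun x => κ x C)
    (hη : ∀ C, MeasurableSet C → Measurable[m] fun x => η x C)
    (h : ∀ C, MeasurableSet C → ∀ D, MeasurableSet[m] D →
      ∫⁻ x in D, κ x C ∂Q = ∫⁻ x in D, η x C ∂Q) : κ =ᵐ[Q] η := by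
  have hset : ∀ C, MeasurableSet C → ∀ᵐ x ∂Q, κ x C = η x C := by
    intro C hC
    refine ae_of_ae_trim hm ?_
    refine ae_eq_of_forall_setLIntegral_eq_of_sigmaFinite (hκ C hC) (hη C hC) fun D hD _ => ?_
    rw [setLIntegral_trim hm (hκ C hC) hD, setLIntegral_trim hm (hη C hC) hD, h C hC D hD]
  -- A countable generating algebra merges the exceptional null sets into one, and as a π-system it
  -- determines a finite measure.
  set 𝒜 := generateSetAlgebra (MeasurableSpace.countableGeneratingSet β)
  have hgen : MeasurableSpace.generateFrom 𝒜 = (inferInstance : MeasurableSpace β) :=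
    generateFrom_generateSetAlgebra_eq.trans MeasurableSpace.generateFrom_countableGeneratingSet
  have hall : ∀ᵐ x ∂Q, ∀ C ∈ 𝒜, κ x C = η x C := by
    rw [ae_ball_iff (countable_generateSetAlgebra
      (MeasurableSpace.countable_countableGeneratingSet (α := β)))]
    refine fun C hC => hset C ?_
    exact hgen.le _ (MeasurableSpace.measurableSet_generateFrom hC)
  filter_upwards [hall, hηp] with x hx hxp
  have := hκp x
  exact ext_of_generate_finite _ hgen.symm
    (fun s hs t ht _ => isSetAlgebra_generateSetAlgebra.inter_mem hs ht) hx (by simp)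

end Disintegration

/-! ### Conditioning on the invariant σ-field and the mean ergodic theorem. -/

section CondInv

variable {X : Type*} [Countable X] [MeasurableSpace X] [MeasurableSingletonClass X]
  {Ω : InvariantSet X}

instance isProbabilityMeasure_condInv (Q : Measure Ω) [IsFiniteMeasure Q] (x : Ω) :
    IsProbabilityMeasure (condInv Q x) := by
  unfold condInv
  infer_instance

theorem measurable_invField_condInv (Q : Measure Ω) [IsFiniteMeasure Q] :
    Measurable[invField Ω] (condInv Q) :=
  (condExpKernel Q (invField Ω)).measurable

theorem measurable_condInv (Q : Measure Ω) [IsFiniteMeasure Q] : Measurable (condInv Q) :=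
  (measurable_invField_condInv Q).mono invField_le le_rfl

theorem measurable_condInv_apply (Q : Measure Ω) [IsFiniteMeasure Q] {C : Set Ω}
    (hC : MeasurableSet C) : Measurable[invField Ω] fun x => condInv Q x C :=
  measurable_condExpKernel hC

theorem measurable_lintegral_condInv (Q : Measure Ω) [IsFiniteMeasure Q] {f : Ω → ℝ≥0∞}
    (hf : Measurable f) : Measurable[invField Ω] fun x => ∫⁻ y, f y ∂(condInv Q x) :=
  (Measure.measurable_lintegral hf).comp (measurable_invField_condInv Q)

theorem setLIntegral_condInv_apply (Q : Measure Ω) [IsFiniteMeasure Q] {C D : Set Ω}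
    (hC : MeasurableSet C) (hD : MeasurableSet[invField Ω] D) :
    ∫⁻ x in D, condInv Q x C ∂Q = Q (C ∩ D) := by
  have h1 := congrArg (fun M : @Measure (Ω × Ω) ((invField Ω).prod inferInstance) => M (D ×ˢ C))
    (compProd_trim_condExpKernel (μ := Q) (invField_le (Ω := Ω)))
  rw [Measure.compProd_apply_prod hD hC, setLIntegral_trim invField_le
    (measurable_condExpKernel hC) hD, Measure.map_apply _ (hD.prod hC)] at h1
  · rw [Set.inter_comm]
    exact h1
  · exact (measurable_id'' invField_le).prodMk measurable_id

theorem setLIntegral_lintegral_condInv (Q : Measure Ω) [IsFiniteMeasure Q] {f : Ω → ℝ≥0∞}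
    (hf : Measurable f) {D : Set Ω} (hD : MeasurableSet[invField Ω] D) :
    ∫⁻ x in D, ∫⁻ y, f y ∂(condInv Q x) ∂Q = ∫⁻ x in D, f x ∂Q := by
  have h1 : (Q.restrict D).bind (condInv Q) = Q.restrict D := Measure.ext fun C hC => by
    rw [Measure.bind_apply hC (measurable_condInv Q).aemeasurable,
      setLIntegral_condInv_apply Q hC hD, Measure.restrict_apply hC]
  rw [← Measure.lintegral_bind (measurable_condInv Q).aemeasurable hf.aemeasurable, h1]

theorem lintegral_condInv_apply (Q : Measure Ω) [IsFiniteMeasure Q] {C : Set Ω}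
    (hC : MeasurableSet C) : ∫⁻ x, condInv Q x C ∂Q = Q C := by
  simpa using setLIntegral_condInv_apply Q hC (@MeasurableSet.univ _ (invField Ω))

/-- Pulling out an invariant factor: the densities `f` and its conditional mean define measures that
agree on invariant sets, hence have the same integrals of invariant functions. -/
theorem lintegral_mul_lintegral_condInv (Q : Measure Ω) [IsFiniteMeasure Q] {f h : Ω → ℝ≥0∞}
    (hf : Measurable f) (hh : Measurable[invField Ω] h) :
    ∫⁻ x, h x * ∫⁻ y, f y ∂(condInv Q x) ∂Q = ∫⁻ x, h x * f x ∂Q := by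
  have h1 : AgreeOnInvariant (Q.withDensity fun x => ∫⁻ y, f y ∂(condInv Q x))
      (Q.withDensity f) := fun D hD => by
    rw [withDensity_apply _ hD.1, withDensity_apply _ hD.1, setLIntegral_lintegral_condInv Q hf hD]
  have h2 := h1.lintegral_eq hh
  have hh' : Measurable h := hh.mono invField_le le_rfl
  rw [lintegral_withDensity_eq_lintegral_mul _
    ((measurable_lintegral_condInv Q hf).mono invField_le le_rfl) hh',
    lintegral_withDensity_eq_lintegral_mul _ hf hh'] at h2
  simpa only [Pi.mul_apply, mul_comm] using h2

theorem condInv_ae_eq_of_setLIntegral {Q : Measure Ω} [IsFiniteMeasure Q] {κ : Ω → Measure Ω}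
    (hκp : ∀ᵐ x ∂Q, IsProbabilityMeasure (κ x))
    (hκ : ∀ C, MeasurableSet C → Measurable[invField Ω] fun x => κ x C)
    (h : ∀ C, MeasurableSet C → ∀ D, MeasurableSet[invField Ω] D →
      ∫⁻ x in D, κ x C ∂Q = Q (C ∩ D)) : condInv Q =ᵐ[Q] κ :=
  ae_eq_of_forall_setLIntegral_apply_eq invField_le (fun _ => inferInstance) hκp
    (fun _ hC => measurable_condInv_apply Q hC) hκ fun C hC D hD => by
      rw [h C hC D hD, setLIntegral_condInv_apply Q hC hD]

theorem condInv_inter_ae_eq (Q : Measure Ω) [IsFiniteMeasure Q] {C D : Set Ω}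
    (hC : MeasurableSet C) (hD : MeasurableSet[invField Ω] D) :
    (fun x => condInv Q x (C ∩ D)) =ᵐ[Q] D.indicator fun x => condInv Q x C := by
  have hCD := measurable_condInv_apply Q (hC.inter hD.1)
  have hind := (measurable_condInv_apply Q hC).indicator hD
  refine ae_eq_of_ae_eq_trim (hm := invField_le) ?_
  refine ae_eq_of_forall_setLIntegral_eq_of_sigmaFinite hCD hind fun E hE _ => ?_
  rw [setLIntegral_trim invField_le hCD hE, setLIntegral_trim invField_le hind hE,
    setLIntegral_condInv_apply Q (hC.inter hD.1) hE, lintegral_indicator hD.1,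
    Measure.restrict_restrict hD.1, setLIntegral_condInv_apply Q hC
      (@MeasurableSet.inter _ (invField Ω) _ _ hD hE), Set.inter_assoc]

/-- The mean ergodic theorem for indicators, with the limit identified. -/
theorem tendstoInMeasure_koopman_averages (Q : Measure Ω) [IsFiniteMeasure Q]
    (hQ : MeasurePreserving (shift Ω) Q Q) {C : Set Ω} (hC : MeasurableSet C) :
    TendstoInMeasure Q
      (fun (n : ℕ) x => (n : ℝ)⁻¹ * ∑ i ∈ Finset.range n, C.indicator (1 : Ω → ℝ) ((shift Ω ^ i) x))
      atTop (fun x => (condInv Q x).real C) := by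
  -- The Koopman operator is an isometry, so von Neumann's theorem gives convergence in L² to the
  -- projection onto its fixed space.
  set U : Lp ℝ 2 Q →L[ℝ] Lp ℝ 2 Q :=
    (Lp.compMeasurePreservingₗᵢ ℝ (shift Ω) hQ).toContinuousLinearMap
  have hU1 : ‖U‖ ≤ 1 := LinearIsometry.norm_toContinuousLinearMap_le _
  have hUind : ∀ {D : Set Ω} (hD : MeasurableSet D),
      U (indicatorConstLp 2 hD (measure_ne_top Q D) 1) =
      indicatorConstLp 2 (measurable_shift hD) (measure_ne_top Q _) 1 := fun hD => by
    exact Lp.indicatorConstLp_compMeasurePreserving hD (measure_ne_top Q _) 1 hQ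
  have hUiter : ∀ i : ℕ, U^[i] (indicatorConstLp 2 hC (measure_ne_top Q C) 1) =
      indicatorConstLp 2 (measurable_shift_pow i hC) (measure_ne_top Q _) 1 := by
    intro i
    induction i with
    | zero => rfl
    | succ i ih =>
      rw [Function.iterate_succ_apply', ih, hUind]
      congr 1
  set f₀ := indicatorConstLp 2 hC (measure_ne_top Q C) (1 : ℝ) with hf₀
  set K := U.eqLocus (1 : Lp ℝ 2 Q →L[ℝ] Lp ℝ 2 Q)
  have hlim := U.tendsto_birkhoffAverage_orthogonalProjection hU1 f₀
  set v : Lp ℝ 2 Q := (K.orthogonalProjectionOnto f₀ : Lp ℝ 2 Q) with hv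
  have hav : ∀ n : ℕ, (birkhoffAverage ℝ U _root_.id n f₀ : Lp ℝ 2 Q) =ᵐ[Q] fun x => (n : ℝ)⁻¹ *
      ∑ i ∈ Finset.range n, C.indicator (1 : Ω → ℝ) ((shift Ω ^ i) x) := by
    intro n
    have h1 : ∀ᵐ x ∂Q, ∀ i : ℕ, (indicatorConstLp 2 (measurable_shift_pow i hC)
        (measure_ne_top Q _) (1 : ℝ) : Lp ℝ 2 Q) x = C.indicator (1 : Ω → ℝ) ((shift Ω ^ i) x) :=
      ae_all_iff.2 fun i => by
        filter_upwards [indicatorConstLp_coeFn (p := 2) (hs := measurable_shift_pow i hC)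
          (hμs := measure_ne_top Q _) (c := (1 : ℝ))] with x hx
        rw [hx]
        rfl
    rw [birkhoffAverage, birkhoffSum]
    simp only [id, hUiter]
    filter_upwards [h1, Lp.coeFn_smul (n : ℝ)⁻¹ (∑ i ∈ Finset.range n, indicatorConstLp 2
      (measurable_shift_pow i hC) (measure_ne_top Q _) (1 : ℝ)), Lp.coeFn_finsetSum
      (Finset.range n)
      (fun i => indicatorConstLp 2 (measurable_shift_pow i hC) (measure_ne_top Q _) (1 : ℝ))]
      with x hx hs ht
    rw [hs, Pi.smul_apply, ht, Finset.sum_apply, smul_eq_mul]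
    simp only [hx]
  have hvinv : U v = v := (K.orthogonalProjectionOnto f₀).2
  -- Indicators of invariant sets are fixed vectors, so self-adjointness moves the projection onto
  -- them, where it does nothing.
  have hvD : ∀ D, MeasurableSet[invField Ω] D → ∫ x in D, v x ∂Q = Q.real (C ∩ D) := by
    intro D hD
    have hDK : indicatorConstLp 2 hD.1 (measure_ne_top Q D) (1 : ℝ) ∈ K := by
      change U _ = _
      rw [hUind hD.1]
      congr 1
      exact hD.2
    rw [← L2.inner_indicatorConstLp_one hD.1 (measure_ne_top Q D)]
    have h2 := Submodule.inner_starProjection_left_eq_right K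
      (indicatorConstLp 2 hD.1 (measure_ne_top Q D) (1 : ℝ)) f₀
    rw [Submodule.starProjection_eq_self_iff.2 hDK] at h2
    rw [hv, ← Submodule.starProjection_apply, ← h2, hf₀, L2.inner_indicatorConstLp_one,
      setIntegral_congr_ae (g := C.indicator fun _ => (1 : ℝ)) hD.1
        (indicatorConstLp_coeFn.mono fun x hx _ => hx), setIntegral_indicator hC]
    simp [Set.inter_comm]
  -- `v` is invariant only almost everywhere. Setting it to zero on the saturation of the
  -- exceptional set gives a strictly invariant version.
  have hvI : AEStronglyMeasurable[invField Ω] v Q := by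
    have hvT : ∀ᵐ x ∂Q, v (shift Ω x) = v x := by
      have := Lp.coeFn_compMeasurePreserving v hQ
      rw [show Lp.compMeasurePreserving _ hQ v = v from hvinv] at this
      exact this.symm
    have hvm : Measurable v := (Lp.stronglyMeasurable v).measurable
    set W : Set Ω := saturation {x | v (shift Ω x) ≠ v x}
    have hW0 : MeasurableSet {x | v (shift Ω x) ≠ v x} :=
      (measurableSet_eq_fun (hvm.comp measurable_shift) hvm).compl
    have hWm : MeasurableSet[invField Ω] W := measurableSet_saturation hW0
    have hWnull : Q W = 0 := measure_saturation_eq_zero hQ hW0 hvT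
    refine ⟨Wᶜ.indicator v, Measurable.stronglyMeasurable (measurable_invField_of_invariant
      (hvm.indicator hWm.1.compl) fun x => ?_), ?_⟩
    · have hx : shift Ω x ∈ W ↔ x ∈ W := by simpa using mem_shift_zpow_iff hWm 1 x
      by_cases h : x ∈ W
      · simp [h, hx.2 h]
      · have h' : shift Ω x ∉ W := fun h' => h (hx.1 h')
        rw [Set.indicator_of_mem (Set.mem_compl h), Set.indicator_of_mem (Set.mem_compl h')]
        by_contra hne
        exact h (mem_saturation.2 ⟨0, by simpa using hne⟩)
    · filter_upwards [compl_mem_ae_iff.2 hWnull] with x hx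
      rw [Set.indicator_of_mem hx]
  have hvc : v =ᵐ[Q] fun x => (condInv Q x).real C := by
    have h1 : v =ᵐ[Q] Q[C.indicator fun _ => (1 : ℝ) | invField Ω] := by
      refine ae_eq_condExp_of_forall_setIntegral_eq invField_le
        ((integrable_const 1).indicator hC) (fun D _ _ => ?_) (fun D hD _ => ?_) hvI
      · exact ((Lp.memLp v).integrable one_le_two).integrableOn
      · rw [hvD D hD, setIntegral_indicator hC]
        simp [Set.inter_comm]
    exact h1.trans (condExpKernel_ae_eq_condExp invField_le hC).symm
  exact (tendstoInMeasure_of_tendsto_Lp hlim).congr hav hvc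

/-- The Cesàro averages are `P`-integrals of the ergodic averages. These converge in `Q`-measure, so
every subsequence has a further one converging `Q`-a.e., hence `P`-a.e., and dominated convergence
applies with bound 1. -/
theorem tendsto_cesaro_of_absolutelyContinuous {P Q : Measure Ω} [IsFiniteMeasure P]
    [IsFiniteMeasure Q] (hQ : MeasurePreserving (shift Ω) Q Q) (hPQ : P ≪ Q) {C : Set Ω}
    (hC : MeasurableSet C) : Tendsto (cesaro P C) atTop (𝓝 (∫⁻ x, condInv Q x C ∂P)) := by
  have hces : ∀ n, cesaro P C n = ∫⁻ x, ENNReal.ofReal ((n : ℝ)⁻¹ *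
      ∑ i ∈ Finset.range n, C.indicator (1 : Ω → ℝ) ((shift Ω ^ i) x)) ∂P := by
    intro n
    rcases Nat.eq_zero_or_pos n with rfl | hn
    · simp [cesaro]
    have h1 : ∀ x, ENNReal.ofReal ((n : ℝ)⁻¹ *
        ∑ i ∈ Finset.range n, C.indicator (1 : Ω → ℝ) ((shift Ω ^ i) x)) =
        (n : ℝ≥0∞)⁻¹ * ∑ i ∈ Finset.range n,
          (⇑(shift Ω ^ i) ⁻¹' C).indicator (1 : Ω → ℝ≥0∞) x := by
      intro x
      rw [ENNReal.ofReal_mul (by positivity), ENNReal.ofReal_inv_of_pos (by positivity),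
        ENNReal.ofReal_natCast, ENNReal.ofReal_sum_of_nonneg]
      · congr 1
        refine Finset.sum_congr rfl fun i _ => ?_
        by_cases h : (shift Ω ^ i) x ∈ C <;> simp [Set.indicator, h]
      · exact fun i _ => Set.indicator_nonneg (fun _ _ => zero_le_one) _
    simp only [h1]
    rw [lintegral_const_mul, lintegral_finsetSum]
    · simp only [lintegral_indicator_one (measurable_shift_pow _ hC), cesaro]
      rw [mul_comm, div_eq_mul_inv]
    · exact fun i _ => measurable_one.indicator (measurable_shift_pow _ hC)
    · exact Finset.measurable_sum _ fun i _ =>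
        measurable_one.indicator (measurable_shift_pow _ hC)
  refine tendsto_of_subseq_tendsto fun ns hns => ?_
  obtain ⟨ms, -, hms⟩ := ((tendstoInMeasure_koopman_averages Q hQ hC).comp hns).exists_seq_tendsto_ae
  refine ⟨ms, ?_⟩
  simp only [hces]
  refine tendsto_lintegral_of_dominated_convergence (fun _ => 1) (fun n => ?_) (fun n => ?_)
    (by simp) ?_
  · refine ENNReal.measurable_ofReal.comp (measurable_const.mul (Finset.measurable_sum _
      fun i _ => ?_))
    exact (measurable_one.indicator hC).comp (measurable_shift_pow i)
  · refine ae_of_all _ fun x => ENNReal.ofReal_le_one.2 ?_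
    refine inv_mul_le_one_of_le₀ ?_ (by positivity)
    refine (Finset.sum_le_card_nsmul _ _ 1 fun i _ => ?_).trans (by simp)
    exact Set.indicator_le_self' (fun _ _ => zero_le_one) _
  · filter_upwards [hPQ.ae_le hms] with x hx
    have := (ENNReal.continuous_ofReal.tendsto _).comp hx
    rwa [ofReal_measureReal (measure_ne_top _ _)] at this

theorem isAMS_of_absolutelyContinuous {P Q : Measure Ω} [IsProbabilityMeasure P]
    [IsFiniteMeasure Q] (hQ : MeasurePreserving (shift Ω) Q Q) (hPQ : P ≪ Q) : IsAMS P :=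
  ⟨inferInstance, fun _ hC => ⟨_, tendsto_cesaro_of_absolutelyContinuous hQ hPQ hC⟩⟩

theorem stationaryMean_apply_of_absolutelyContinuous {P Q : Measure Ω} [IsProbabilityMeasure P]
    [IsFiniteMeasure Q] (hQ : MeasurePreserving (shift Ω) Q Q) (hPQ : P ≪ Q) {C : Set Ω}
    (hC : MeasurableSet C) : stationaryMean P C = ∫⁻ x, condInv Q x C ∂P :=
  tendsto_nhds_unique
    (tendsto_cesaro_stationaryMean (isAMS_of_absolutelyContinuous hQ hPQ) hC)
    (tendsto_cesaro_of_absolutelyContinuous hQ hPQ hC)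

theorem stationaryMean_eq_of_agreeOnInvariant {P Q : Measure Ω} [IsProbabilityMeasure P]
    [IsFiniteMeasure Q] (hQ : MeasurePreserving (shift Ω) Q Q) (h : AgreeOnInvariant P Q) :
    stationaryMean P = Q := Measure.ext fun C hC => by
  rw [stationaryMean_apply_of_absolutelyContinuous hQ
    (absolutelyContinuous_of_agreeOnInvariant hQ h) hC,
    h.lintegral_eq (measurable_condInv_apply Q hC), lintegral_condInv_apply Q hC]

/-- The conditional measures of a stationary mean are those of any dominating stationary
measure. -/
theorem condInv_stationaryMean_ae_eq {P Q : Measure Ω} [IsProbabilityMeasure P]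
    [IsFiniteMeasure Q] (hQ : MeasurePreserving (shift Ω) Q Q) (hPQ : P ≪ Q) :
    condInv (stationaryMean P) =ᵐ[stationaryMean P] condInv Q := by
  have hP := isAMS_of_absolutelyContinuous hQ hPQ
  refine condInv_ae_eq_of_setLIntegral (ae_of_all _ fun _ => inferInstance)
    (fun C hC => measurable_condInv_apply Q hC) fun C hC D hD => ?_
  have hind : Measurable[invField Ω] (D.indicator fun x => condInv Q x C) :=
    (measurable_condInv_apply Q hC).indicator hD
  rw [← lintegral_indicator hD.1, ← (agreeOnInvariant_stationaryMean hP).lintegral_eq hind,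
    stationaryMean_apply_of_absolutelyContinuous hQ hPQ (hC.inter hD.1)]
  exact lintegral_congr_ae (hPQ.ae_le (condInv_inter_ae_eq Q hC hD).symm)

end CondInv

/-! ### Combinatorics of the blocks of a self-avoiding code. -/

section SelfAvoiding

variable {X Y : Type*} [MeasurableSpace X] [MeasurableSpace Y]
  {ΩX : InvariantSet X} {ΩY : InvariantSet Y} {g : ΩX → ΩY}

/-- The quasi-period as a natural number. -/
noncomputable def period (g : ΩX → ΩY) (x : ΩX) : ℕ := (quasiPeriod g x).toNat

namespace IsSelfAvoiding

theorem measurable (hg : IsSelfAvoiding g) : Measurable g := hg.1.1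

theorem injective (hg : IsSelfAvoiding g) : Function.Injective g := hg.1.2.1

theorem coe_period (hg : IsSelfAvoiding g) (x : ΩX) : (period g x : ℕ∞) = quasiPeriod g x :=
  ENat.natCast_toNat (hg.2.1.2 x).ne

theorem qpLength_eq (hg : IsSelfAvoiding g) (x : ΩX) : qpLength g x = period g x := by
  rw [qpLength, ← hg.coe_period x]
  simp

theorem period_spec (hg : IsSelfAvoiding g) (x : ΩX) :
    1 ≤ period g x ∧ (shift ΩY ^ period g x) (g x) = g (shift ΩX x) := by
  have hne : {m : ℕ∞ | ∃ l : ℕ, m = l ∧ 1 ≤ l ∧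
      (shift ΩY ^ l) (g x) = g (shift ΩX x)}.Nonempty := by
    by_contra h
    have := hg.2.1.2 x
    rw [quasiPeriod, Set.not_nonempty_iff_eq_empty.1 h, sInf_empty] at this
    exact this.ne rfl
  obtain ⟨l, hl, h1, h2⟩ := csInf_mem hne
  have : period g x = l := by
    rw [period, quasiPeriod, hl, ENat.toNat_natCast]
  rw [this]
  exact ⟨h1, h2⟩

theorem period_le (hg : IsSelfAvoiding g) {x : ΩX} {l : ℕ} (hl : 1 ≤ l)
    (h : (shift ΩY ^ l) (g x) = g (shift ΩX x)) : period g x ≤ l := by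
  have : quasiPeriod g x ≤ l := sInf_le ⟨l, rfl, hl, h⟩
  rw [← hg.coe_period x] at this
  exact_mod_cast this

theorem period_eq_iff (hg : IsSelfAvoiding g) {x : ΩX} {l : ℕ} : period g x = l ↔
    (1 ≤ l ∧ (shift ΩY ^ l) (g x) = g (shift ΩX x)) ∧
      ∀ k < l, 1 ≤ k → (shift ΩY ^ k) (g x) ≠ g (shift ΩX x) := by
  constructor
  · rintro rfl
    exact ⟨hg.period_spec x, fun k hk h1 h => (hg.period_le h1 h).not_gt hk⟩
  · rintro ⟨⟨h1, h2⟩, h3⟩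
    refine le_antisymm (hg.period_le h1 h2) (not_lt.1 fun h => ?_)
    exact h3 _ h (hg.period_spec x).1 (hg.period_spec x).2

/-- The blocks `g x, T (g x), …, T^{L - 1} (g x)` of different points are disjoint. -/
theorem eq_of_shift_pow_eq (hg : IsSelfAvoiding g) {x x' : ΩX} {l k : ℕ} (hl : l < period g x)
    (hk : k < period g x') (h : (shift ΩY ^ l) (g x) = (shift ΩY ^ k) (g x')) :
    l = k ∧ x = x' := by
  have key : ∀ {x x' : ΩX} {l k : ℕ}, l < period g x →
      (shift ΩY ^ l) (g x) = (shift ΩY ^ k) (g x') → k ≤ l → l = k ∧ x = x' := by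
    intro x x' l k hl h hkl
    -- A return to the range after `l - k` steps, fewer than the quasi-period, is possible only if
    -- `l - k ≤ 0`.
    have h1 : (shift ΩY ^ ((l : ℤ) - k)) (g x) = g x' := by
      rw [sub_eq_neg_add, zpow_add, Equiv.Perm.mul_apply, zpow_natCast, h, ← zpow_natCast,
        ← Equiv.Perm.mul_apply, ← zpow_add]
      simp
    have h2 : (l : ℤ) - k ≤ 0 ∨ (period g x : ℤ) ≤ (l : ℤ) - k := hg.2.2 x _ ⟨x', h1.symm⟩
    have hlk : l = k := by omega
    subst hlk
    exact ⟨rfl, hg.injective (by simpa using h1)⟩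
  rcases le_total k l with hkl | hkl
  · exact key hl h hkl
  · exact (key hk h.symm hkl).imp Eq.symm Eq.symm

end IsSelfAvoiding

/-- The measure `∑_{l < L_g(x)} δ_{T^l g(x)}`. -/
noncomputable def blockMeasure (g : ΩX → ΩY) (x : ΩX) : Measure ΩY :=
  ∑ l ∈ Finset.range (quasiPeriod g x).toNat, Measure.dirac ((shift ΩY ^ l) (g x))

theorem blockMeasure_apply (g : ΩX → ΩY) (x : ΩX) {B : Set ΩY} (hB : MeasurableSet B) :
    blockMeasure g x B = spread g B x := by
  simp only [blockMeasure, spread, Measure.finsetSum_apply, Measure.dirac_apply' _ hB]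

theorem spread_inter_of_invariant (g : ΩX → ΩY) (B : Set ΩY) {D : Set ΩY}
    (hD : MeasurableSet[invField ΩY] D) :
    spread g (B ∩ D) = (g ⁻¹' D).indicator (spread g B) := by
  ext x
  have h : ∀ l : ℕ, (shift ΩY ^ l) (g x) ∈ D ↔ g x ∈ D := fun l => by
    simpa using mem_shift_zpow_iff hD l (g x)
  by_cases hx : g x ∈ D
  · rw [Set.indicator_of_mem (show x ∈ g ⁻¹' D from hx)]
    refine Finset.sum_congr rfl fun l _ => ?_
    have hl : (shift ΩY ^ l) (g x) ∈ D := (h l).2 hx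
    by_cases hB : (shift ΩY ^ l) (g x) ∈ B
    · rw [Set.indicator_of_mem hB, Set.indicator_of_mem (Set.mem_inter hB hl)]
    · rw [Set.indicator_of_notMem hB, Set.indicator_of_notMem fun hh : _ ∈ B ∩ D => hB hh.1]
  · rw [Set.indicator_of_notMem (show x ∉ g ⁻¹' D from hx)]
    exact Finset.sum_eq_zero fun l _ =>
      Set.indicator_of_notMem (fun hl => hx ((h l).1 hl.2)) _

namespace IsSelfAvoiding

theorem spread_univ (hg : IsSelfAvoiding g) : spread g Set.univ = qpLength g := by
  ext x
  rw [hg.qpLength_eq]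
  simp [spread, period]

theorem one_le_qpLength (hg : IsSelfAvoiding g) (x : ΩX) : 1 ≤ qpLength g x := by
  rw [hg.qpLength_eq]
  exact_mod_cast (hg.period_spec x).1

theorem one_le_lintegral_qpLength (hg : IsSelfAvoiding g) (f : Measure ΩX)
    [IsProbabilityMeasure f] : 1 ≤ ∫⁻ x, qpLength g x ∂f :=
  calc (1 : ℝ≥0∞) = ∫⁻ _, 1 ∂f := by simp
    _ ≤ _ := lintegral_mono hg.one_le_qpLength

/-- Telescoping: the shifted block loses `g x` and gains T^L g(x) = g(Tx). The additive form again
avoids subtraction. -/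
theorem spread_preimage_shift (hg : IsSelfAvoiding g) (B : Set ΩY) (x : ΩX) :
    spread g (shift ΩY ⁻¹' B) x + B.indicator 1 (g x) =
      spread g B x + B.indicator 1 (g (shift ΩX x)) := by
  have h := Finset.sum_range_succ (fun l => B.indicator (1 : ΩY → ℝ≥0∞) ((shift ΩY ^ l) (g x)))
    (period g x)
  rw [Finset.sum_range_succ', (hg.period_spec x).2] at h
  rw [spread, spread]
  refine Eq.trans ?_ h
  congr 1
  refine Finset.sum_congr rfl fun l _ => ?_
  rw [pow_succ', Equiv.Perm.mul_apply]
  rfl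

/-- By self-avoidance only the term `l = 0` of a block lies in the range of `g`. -/
theorem spread_image (hg : IsSelfAvoiding g) (A : Set ΩX) :
    spread g (g '' A) = A.indicator 1 := by
  ext x
  obtain ⟨n, hn⟩ := Nat.exists_eq_add_of_le' (hg.period_spec x).1
  rw [spread, ← period, hn, Finset.sum_range_succ', Finset.sum_eq_zero, zero_add]
  · by_cases hx : x ∈ A
    · rw [Set.indicator_of_mem hx, pow_zero, Equiv.Perm.one_apply,
        Set.indicator_of_mem (Set.mem_image_of_mem g hx)]
      rfl
    · rw [Set.indicator_of_notMem hx, pow_zero, Equiv.Perm.one_apply, Set.indicator_of_notMem]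
      exact fun h => hx (hg.injective.mem_set_image.1 h)
  · intro l hl
    refine Set.indicator_of_notMem ?_ _
    rintro ⟨x', -, hx'⟩
    have hl' := Finset.mem_range.1 hl
    have := (hg.eq_of_shift_pow_eq (x := x) (x' := x') (l := l + 1) (k := 0) (by omega)
      (hg.period_spec x').1 (by simpa using hx'.symm)).1
    omega

theorem apply_shift_of_invariant (hg : IsSelfAvoiding g) {β : Type*} {F : ΩY → β}
    (hF : ∀ y, F (shift ΩY y) = F y) (x : ΩX) : F (g (shift ΩX x)) = F (g x) := by
  rw [← (hg.period_spec x).2, ← zpow_natCast, apply_shift_zpow_of_invariant hF]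

theorem measurable_invField (hg : IsSelfAvoiding g) : Measurable[invField ΩX, invField ΩY] g :=
  fun D hD => ⟨hg.measurable hD.1, Set.ext fun x => iff_of_eq
    (hg.apply_shift_of_invariant (F := fun y => y ∈ D)
      (fun y => (congrArg (fun E : Set ΩY => y ∈ E) hD.2 : (y ∈ shift ΩY ⁻¹' D) = _)) x)⟩

theorem measurable_period [Countable Y] [MeasurableSingletonClass Y]
    (hg : IsSelfAvoiding g) : Measurable (period g) := by
  refine measurable_to_countable' fun l => ?_
  have h : period g ⁻¹' {l} = {x | (1 ≤ l ∧ (shift ΩY ^ l) (g x) = g (shift ΩX x)) ∧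
      ∀ k < l, 1 ≤ k → (shift ΩY ^ k) (g x) ≠ g (shift ΩX x)} :=
    Set.ext fun x => hg.period_eq_iff
  have hm : ∀ k : ℕ, Measurable fun x => (shift ΩY ^ k) (g x) = g (shift ΩX x) := fun k =>
    measurableSet_setOfPred.1 (measurableSet_eq_fun ((measurable_shift_pow k).comp hg.measurable)
      (hg.measurable.comp measurable_shift))
  rw [h]
  refine measurableSet_setOfPred.2 ?_
  refine (measurable_const.and (hm l)).and ?_
  exact Measurable.forall fun k => measurable_const.imp (measurable_const.imp (hm k).not)

end IsSelfAvoiding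

end SelfAvoiding

/-! ### Measurability of the transports; invariant measures under the code. -/

section Measurability

set_option linter.unusedSectionVars false

variable {X Y : Type*} [Countable X] [MeasurableSpace X] [MeasurableSingletonClass X]
  [Countable Y] [MeasurableSpace Y] [MeasurableSingletonClass Y]
  {ΩX : InvariantSet X} {ΩY : InvariantSet Y} {g : ΩX → ΩY}

namespace IsSelfAvoiding

theorem measurableEmbedding (hg : IsSelfAvoiding g) : MeasurableEmbedding g :=
  hg.measurable.measurableEmbedding hg.injective

theorem measurable_qpLength (hg : IsSelfAvoiding g) : Measurable (qpLength g) := by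
  rw [funext hg.qpLength_eq]
  exact (measurable_from_nat (f := fun n : ℕ => (n : ℝ≥0∞))).comp hg.measurable_period

theorem measurable_spread (hg : IsSelfAvoiding g) {B : Set ΩY} (hB : MeasurableSet B) :
    Measurable (spread g B) := by
  have h : Measurable fun p : ℕ × ΩX =>
      ∑ l ∈ Finset.range p.1, B.indicator (1 : ΩY → ℝ≥0∞) ((shift ΩY ^ l) (g p.2)) :=
    measurable_from_prod_countable_right fun n => Finset.measurable_sum (Finset.range n) fun l _ =>
      (measurable_one.indicator hB).comp ((measurable_shift_pow l).comp hg.measurable)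
  exact h.comp (hg.measurable_period.prodMk measurable_id)

theorem measurable_blockMeasure (hg : IsSelfAvoiding g) : Measurable (blockMeasure g) :=
  Measure.measurable_of_measurable_coe _ fun B hB => by
    simpa only [blockMeasure_apply g _ hB] using hg.measurable_spread hB

theorem normTransport_apply (hg : IsSelfAvoiding g) (f : Measure ΩX) {B : Set ΩY}
    (hB : MeasurableSet B) :
    normTransport g f B = (∫⁻ x, spread g B x ∂f) / ∫⁻ x, qpLength g x ∂f := by
  have h : f.bind (blockMeasure g) B = ∫⁻ x, spread g B x ∂f := by
    rw [Measure.bind_apply hB hg.measurable_blockMeasure.aemeasurable]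
    simp only [blockMeasure_apply g _ hB]
  rw [div_eq_mul_inv, mul_comm, ← h]
  rfl

theorem normTransportInv_apply (hg : IsSelfAvoiding g) (f : Measure ΩY) (A : Set ΩX) :
    normTransportInv g f A = f (g '' A) / f (Set.range g) := by
  rw [normTransportInv, Measure.smul_apply, hg.measurableEmbedding.comap_apply, smul_eq_mul,
    div_eq_mul_inv, mul_comm]

theorem measurable_normTransport (hg : IsSelfAvoiding g) : Measurable (normTransport g) :=
  Measure.measurable_of_measurable_coe _ fun B hB => by
    simp only [hg.normTransport_apply _ hB]
    exact (Measure.measurable_lintegral (hg.measurable_spread hB)).div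
      (Measure.measurable_lintegral hg.measurable_qpLength)

theorem measurable_normTransportInv (hg : IsSelfAvoiding g) : Measurable (normTransportInv g) :=
  Measure.measurable_of_measurable_coe _ fun A hA => by
    simp only [hg.normTransportInv_apply]
    exact (Measure.measurable_coe (hg.measurableEmbedding.measurableSet_image' hA)).div
      (Measure.measurable_coe hg.measurableEmbedding.measurableSet_range)

theorem isProbabilityMeasure_normTransport (hg : IsSelfAvoiding g) (f : Measure ΩX)
    [IsProbabilityMeasure f] (hf : ∫⁻ x, qpLength g x ∂f < ∞) :
    IsProbabilityMeasure (normTransport g f) := ⟨by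
  rw [hg.normTransport_apply f MeasurableSet.univ, hg.spread_univ]
  exact ENNReal.div_self (zero_lt_one.trans_le (hg.one_le_lintegral_qpLength f)).ne' hf.ne⟩

/-- On g(A) the spread is the indicator of A, so C_g(f) takes the value f(A)/∫L_g df there, and the
common denominator cancels. -/
theorem normTransportInv_normTransport (hg : IsSelfAvoiding g) (f : Measure ΩX)
    [IsProbabilityMeasure f] (hf : ∫⁻ x, qpLength g x ∂f < ∞) :
    normTransportInv g (normTransport g f) = f := Measure.ext fun A hA => by
  have h : ∀ A, MeasurableSet A →
      normTransport g f (g '' A) = f A / ∫⁻ x, qpLength g x ∂f := fun A hA => by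
    rw [hg.normTransport_apply f (hg.measurableEmbedding.measurableSet_image' hA),
      hg.spread_image, lintegral_indicator_one hA]
  have h0 := (zero_lt_one.trans_le (hg.one_le_lintegral_qpLength f)).ne'
  rw [hg.normTransportInv_apply, ← Set.image_univ, h A hA, h _ MeasurableSet.univ, measure_univ,
    one_div, div_eq_mul_inv, div_eq_mul_inv, inv_inv, mul_assoc, ENNReal.inv_mul_cancel h0 hf.ne,
    mul_one]

/-- Every invariant event of the source is the preimage of an invariant event of the target. -/
theorem exists_preimage_eq (hg : IsSelfAvoiding g) {D : Set ΩX}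
    (hD : MeasurableSet[invField ΩX] D) :
    ∃ D', MeasurableSet[invField ΩY] D' ∧ g ⁻¹' D' = D := by
  refine ⟨saturation (g '' D), measurableSet_saturation
    (hg.measurableEmbedding.measurableSet_image' hD.1), Set.ext fun x => ?_⟩
  rw [Set.mem_preimage, mem_saturation]
  constructor
  · rintro ⟨j, d, hd, hj⟩
    -- Synchronizability: images on one orbit come from points on one orbit.
    obtain ⟨i, hi⟩ := (hg.1.2.2 x d).2 ⟨j, hj.symm⟩
    rw [← mem_shift_zpow_iff hD i, hi]
    exact hd
  · exact fun hx => ⟨0, x, hx, by simp⟩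

/-- The measure on the target built from an invariant measure on the source by filling in the
blocks is invariant. -/
theorem measurePreserving_bind_blockMeasure (hg : IsSelfAvoiding g) {M : Measure ΩX}
    [IsFiniteMeasure M] (hM : MeasurePreserving (shift ΩX) M M) :
    MeasurePreserving (shift ΩY) (M.bind (blockMeasure g)) (M.bind (blockMeasure g)) := by
  refine ⟨measurable_shift, Measure.ext fun B hB => ?_⟩
  have hind : Measurable fun x => B.indicator (1 : ΩY → ℝ≥0∞) (g x) :=
    (measurable_one.indicator hB).comp hg.measurable
  rw [Measure.map_apply measurable_shift hB,
    Measure.bind_apply (measurable_shift hB) hg.measurable_blockMeasure.aemeasurable,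
    Measure.bind_apply hB hg.measurable_blockMeasure.aemeasurable]
  simp only [blockMeasure_apply g _ hB, blockMeasure_apply g _ (measurable_shift hB)]
  have h := lintegral_congr (μ := M) (hg.spread_preimage_shift B)
  rw [lintegral_add_right _ hind, lintegral_add_left (hg.measurable_spread hB),
    hM.lintegral_comp hind] at h
  -- The boundary terms have equal integrals by invariance of `M`, and cancel because `M` is finite.
  refine (ENNReal.add_left_inj ?_).1 h
  refine ((lintegral_mono fun x => Set.indicator_le_self' (fun _ _ => zero_le_one) _).trans_lt
    (?_ : ∫⁻ _, 1 ∂M < ∞)).ne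
  simp [measure_lt_top]

/-- The restriction of an invariant measure on the target to the range of the code is an invariant
measure on the source. -/
theorem measurePreserving_comap (hg : IsSelfAvoiding g) {R : Measure ΩY}
    (hR : MeasurePreserving (shift ΩY) R R) :
    MeasurePreserving (shift ΩX) (R.comap g) (R.comap g) := by
  refine ⟨measurable_shift, Measure.ext fun A hA => ?_⟩
  have he := hg.measurableEmbedding
  rw [Measure.map_apply measurable_shift hA, he.comap_apply, he.comap_apply]
  -- Splitting by the quasi-period `l`, the map T^l carries `g '' V l` onto `W l`, the images of the
  -- shifted points. These pieces partition `g '' A`.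
  set V : ℕ → Set ΩX := fun l => shift ΩX ⁻¹' A ∩ period g ⁻¹' {l}
  have hV : ∀ l, MeasurableSet (V l) := fun l =>
    (measurable_shift hA).inter (hg.measurable_period (measurableSet_singleton l))
  set W : ℕ → Set ΩY := fun l => ⇑(shift ΩY ^ (-(l : ℤ))) ⁻¹' (g '' V l)
  have hV' : g '' (shift ΩX ⁻¹' A) = ⋃ l, g '' V l := by
    rw [← Set.image_iUnion]
    congr 1
    ext x
    simp [V]
  have hmem : ∀ x l, x ∈ V l → g (shift ΩX x) = (shift ΩY ^ (l : ℤ)) (g x) := by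
    rintro x l ⟨-, hx⟩
    rw [← (hg.period_spec x).2, show period g x = l from hx, zpow_natCast]
  have hWV : ∀ l y, y ∈ W l ↔ ∃ x ∈ V l, g (shift ΩX x) = y := by
    intro l y
    refine exists_congr fun x => and_congr_right fun hx => ?_
    rw [hmem x l hx, zpow_neg, Equiv.Perm.eq_inv_iff_eq]
  have hW' : g '' A = ⋃ l, W l := by
    ext y
    simp only [Set.mem_iUnion, hWV]
    constructor
    · rintro ⟨x, hx, rfl⟩
      exact ⟨_, (shift ΩX).symm x, ⟨by simpa using hx, rfl⟩, by simp⟩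
    · rintro ⟨l, x, hx, rfl⟩
      exact ⟨_, hx.1, rfl⟩
  have hVd : Pairwise (Function.onFun Disjoint V) := fun l k hlk =>
    Set.disjoint_left.2 fun x hx hx' => hlk (hx.2.symm.trans hx'.2)
  have hWd : Pairwise (Function.onFun Disjoint W) := fun l k hlk =>
    Set.disjoint_left.2 fun y hy hy' => by
      obtain ⟨x, hx, rfl⟩ := (hWV l y).1 hy
      obtain ⟨x', hx', h⟩ := (hWV k _).1 hy'
      obtain rfl := (shift ΩX).injective (hg.injective h)
      exact hlk (hx.2.symm.trans hx'.2)
  have hm : ∀ l, MeasurableSet (g '' V l) := fun l => he.measurableSet_image' (hV l)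
  rw [hV', hW', measure_iUnion (fun l k hlk => (Set.disjoint_image_iff hg.injective).2 (hVd hlk)) hm,
    measure_iUnion hWd fun l => measurable_shift_zpow _ (hm l)]
  exact tsum_congr fun l => (measure_preimage_shift_zpow hR _ (hm l)).symm

/-- Kac's inequality. -/
theorem lintegral_qpLength_comap_le (hg : IsSelfAvoiding g) {R : Measure ΩY}
    (hR : MeasurePreserving (shift ΩY) R R) :
    ∫⁻ x, qpLength g x ∂(R.comap g) ≤ R Set.univ := by
  have he := hg.measurableEmbedding
  -- The `W l` are the floors of a tower over the range of `g`. They are disjoint, but need not fill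
  -- the space, whence only an inequality.
  set V : ℕ → Set ΩX := fun l => {x | l < period g x}
  have hV : ∀ l, MeasurableSet (V l) := fun l => hg.measurable_period measurableSet_Ioi
  have hm : ∀ l, MeasurableSet (g '' V l) := fun l => he.measurableSet_image' (hV l)
  set W : ℕ → Set ΩY := fun l => ⇑(shift ΩY ^ (-(l : ℤ))) ⁻¹' (g '' V l)
  have hW : ∀ l y, y ∈ W l → ∃ x, l < period g x ∧ (shift ΩY ^ l) (g x) = y := by
    rintro l y ⟨x, hx, h⟩
    refine ⟨x, hx, ?_⟩
    rw [h, ← zpow_natCast, ← Equiv.Perm.mul_apply, ← zpow_add]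
    simp
  have hWd : Pairwise (Function.onFun Disjoint W) := fun l k hlk =>
    Set.disjoint_left.2 fun y hy hy' => by
      obtain ⟨x, hx, rfl⟩ := hW l y hy
      obtain ⟨x', hx', h⟩ := hW k _ hy'
      exact hlk (hg.eq_of_shift_pow_eq hx hx' h.symm).1
  have hL : ∀ x, qpLength g x = ∑' l, (V l).indicator (1 : ΩX → ℝ≥0∞) x := by
    intro x
    rw [hg.qpLength_eq, tsum_eq_sum (s := Finset.range (period g x))]
    · rw [Finset.sum_congr rfl fun l hl => Set.indicator_of_mem
        (show x ∈ V l from Finset.mem_range.1 hl) (1 : ΩX → ℝ≥0∞)]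
      simp
    · intro l hl
      exact Set.indicator_of_notMem (fun h : x ∈ V l => hl (Finset.mem_range.2 h)) _
  simp only [hL]
  rw [lintegral_tsum fun l => (measurable_one.indicator (hV l)).aemeasurable]
  simp only [lintegral_indicator_one (hV _), he.comap_apply]
  calc ∑' l, R (g '' V l) = ∑' l, R (W l) :=
        tsum_congr fun l => (measure_preimage_shift_zpow hR _ (hm l)).symm
    _ = R (⋃ l, W l) := (measure_iUnion hWd fun l => measurable_shift_zpow _ (hm l)).symm
    _ ≤ _ := measure_mono (Set.subset_univ _)

end IsSelfAvoiding

end Measurability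

/-! ### Transport of stationary means, conditional measures and priors. -/

section Transport

set_option linter.unusedSectionVars false

variable {X Y : Type*} [Countable X] [MeasurableSpace X] [MeasurableSingletonClass X]
  [Countable Y] [MeasurableSpace Y] [MeasurableSingletonClass Y]
  {ΩX : InvariantSet X} {ΩY : InvariantSet Y} {g : ΩX → ΩY}

theorem measurePreserving_withDensity {Q : Measure ΩX} (hQ : MeasurePreserving (shift ΩX) Q Q)
    {h : ΩX → ℝ≥0∞} (hh : Measurable[invField ΩX] h) :
    MeasurePreserving (shift ΩX) (Q.withDensity h) (Q.withDensity h) := by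
  have hm : Measurable h := hh.mono invField_le le_rfl
  refine ⟨measurable_shift, Measure.ext fun A hA => ?_⟩
  rw [Measure.map_apply measurable_shift hA, withDensity_apply _ (measurable_shift hA),
    withDensity_apply _ hA, ← lintegral_indicator (measurable_shift hA), ← lintegral_indicator hA,
    ← hQ.lintegral_comp (hm.indicator hA)]
  refine lintegral_congr fun x => ?_
  by_cases hx : shift ΩX x ∈ A
  · rw [Set.indicator_of_mem (show x ∈ shift ΩX ⁻¹' A from hx), Set.indicator_of_mem hx,
      apply_shift_of_measurable_invField hh]
  · rw [Set.indicator_of_notMem (show x ∉ shift ΩX ⁻¹' A from hx), Set.indicator_of_notMem hx]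

/-- The reciprocal of the conditional mean of the quasi-period. -/
noncomputable def blockRate (g : ΩX → ΩY) (Q : Measure ΩX) [IsFiniteMeasure Q] (x : ΩX) : ℝ≥0∞ :=
  (∫⁻ x', qpLength g x' ∂(condInv Q x))⁻¹

/-- The stationary measure on the target that corresponds to the stationary measure `Q` on the
source. -/
noncomputable def stationaryTransport (g : ΩX → ΩY) (Q : Measure ΩX) [IsFiniteMeasure Q] :
    Measure ΩY :=
  (Q.withDensity (blockRate g Q)).bind (blockMeasure g)

namespace IsSelfAvoiding

theorem measurable_blockRate (hg : IsSelfAvoiding g) (Q : Measure ΩX) [IsFiniteMeasure Q] :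
    Measurable[invField ΩX] (blockRate g Q) :=
  (measurable_lintegral_condInv Q hg.measurable_qpLength).inv

theorem isFiniteMeasure_withDensity_blockRate (hg : IsSelfAvoiding g) (Q : Measure ΩX)
    [IsFiniteMeasure Q] : IsFiniteMeasure (Q.withDensity (blockRate g Q)) := by
  refine isFiniteMeasure_withDensity (ne_top_of_le_ne_top (measure_ne_top Q Set.univ) ?_)
  calc ∫⁻ x, blockRate g Q x ∂Q ≤ ∫⁻ _, 1 ∂Q :=
        lintegral_mono fun x => ENNReal.inv_le_one.2 (hg.one_le_lintegral_qpLength _)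
    _ = Q Set.univ := by simp

theorem stationaryTransport_apply (hg : IsSelfAvoiding g) (Q : Measure ΩX) [IsFiniteMeasure Q]
    {B : Set ΩY} (hB : MeasurableSet B) :
    stationaryTransport g Q B = ∫⁻ x, blockRate g Q x * spread g B x ∂Q := by
  rw [stationaryTransport, Measure.bind_apply hB hg.measurable_blockMeasure.aemeasurable]
  simp only [blockMeasure_apply g _ hB]
  rw [lintegral_withDensity_eq_lintegral_mul _
    ((hg.measurable_blockRate Q).mono invField_le le_rfl) (hg.measurable_spread hB)]
  rfl

/-- The link between the fibrewise and the global construction: the denominator of C_g is invariant,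
so it can be pulled out of the conditional integral together with the indicator of g⁻¹(D). -/
theorem setLIntegral_normTransport_condInv (hg : IsSelfAvoiding g) (Q : Measure ΩX)
    [IsFiniteMeasure Q] {B D : Set ΩY} (hB : MeasurableSet B)
    (hD : MeasurableSet[invField ΩY] D) :
    ∫⁻ x in g ⁻¹' D, normTransport g (condInv Q x) B ∂Q = stationaryTransport g Q (B ∩ D) := by
  have hgD : MeasurableSet[invField ΩX] (g ⁻¹' D) := hg.measurable_invField hD
  rw [hg.stationaryTransport_apply Q (hB.inter hD.1), spread_inter_of_invariant g B hD,
    ← lintegral_indicator hgD.1]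
  have h := lintegral_mul_lintegral_condInv Q (hg.measurable_spread hB)
    ((hg.measurable_blockRate Q).indicator hgD)
  refine Eq.trans (lintegral_congr fun x => ?_) (h.trans (lintegral_congr fun x => ?_))
  · by_cases hx : x ∈ g ⁻¹' D
    · rw [Set.indicator_of_mem hx, Set.indicator_of_mem hx, hg.normTransport_apply _ hB,
        div_eq_mul_inv, mul_comm]
      rfl
    · rw [Set.indicator_of_notMem hx, Set.indicator_of_notMem hx, zero_mul]
  · by_cases hx : x ∈ g ⁻¹' D
    · rw [Set.indicator_of_mem hx, Set.indicator_of_mem hx]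
    · rw [Set.indicator_of_notMem hx, Set.indicator_of_notMem hx, zero_mul, mul_zero]

theorem measurePreserving_stationaryTransport (hg : IsSelfAvoiding g) {Q : Measure ΩX}
    [IsFiniteMeasure Q] (hQ : MeasurePreserving (shift ΩX) Q Q) :
    MeasurePreserving (shift ΩY) (stationaryTransport g Q) (stationaryTransport g Q) := by
  have := hg.isFiniteMeasure_withDensity_blockRate Q
  exact hg.measurePreserving_bind_blockMeasure
    (measurePreserving_withDensity hQ (hg.measurable_blockRate Q))

/-- Where the conditional mean of L_g is finite, C_g of the conditional measure has total mass 1.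
This is why the weight is the conditional mean and not the global one. -/
theorem stationaryTransport_of_invariant (hg : IsSelfAvoiding g) {Q : Measure ΩX}
    [IsFiniteMeasure Q] (hfin : ∀ᵐ x ∂Q, ∫⁻ x', qpLength g x' ∂(condInv Q x) < ∞) {D : Set ΩY}
    (hD : MeasurableSet[invField ΩY] D) : stationaryTransport g Q D = Q (g ⁻¹' D) := by
  have h := hg.setLIntegral_normTransport_condInv Q MeasurableSet.univ hD
  rw [Set.univ_inter] at h
  rw [← h, ← setLIntegral_one]
  refine lintegral_congr_ae (ae_restrict_of_ae ?_)
  filter_upwards [hfin] with x hx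
  exact (hg.isProbabilityMeasure_normTransport _ hx).measure_univ

theorem isFiniteMeasure_stationaryTransport (hg : IsSelfAvoiding g) {Q : Measure ΩX}
    [IsFiniteMeasure Q] (hfin : ∀ᵐ x ∂Q, ∫⁻ x', qpLength g x' ∂(condInv Q x) < ∞) :
    IsFiniteMeasure (stationaryTransport g Q) := ⟨by
  rw [hg.stationaryTransport_of_invariant hfin (@MeasurableSet.univ _ (invField ΩY))]
  exact measure_lt_top _ _⟩

theorem measurableSet_lintegral_qpLength_lt_top (hg : IsSelfAvoiding g) (Q : Measure ΩX)
    [IsFiniteMeasure Q] :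
    MeasurableSet[invField ΩX] {x | ∫⁻ x', qpLength g x' ∂(condInv Q x) < ∞} :=
  measurable_lintegral_condInv Q hg.measurable_qpLength measurableSet_Iio

theorem plainTransport_iff (hg : IsSelfAvoiding g) {PX : Measure ΩX} {PY : Measure ΩY} :
    PlainTransport g PX PY ↔ PY = PX.map g := by
  refine ⟨fun h => Measure.ext fun B hB => ?_, ?_⟩
  · rw [h B hB, Measure.map_apply hg.measurable hB]
  · rintro rfl B hB
    exact Measure.map_apply hg.measurable hB

/-- Finiteness of the conditional mean is an invariant event, so it has the same probability under P
and its stationary mean. -/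
theorem ae_lintegral_qpLength_lt_top (hg : IsSelfAvoiding g) {P : Measure ΩX}
    (hP : P ∈ AMSSource g) : ∀ᵐ x ∂(stationaryMean P),
      ∫⁻ x', qpLength g x' ∂(condInv (stationaryMean P) x) < ∞ :=
  ((agreeOnInvariant_stationaryMean hP.1).ae_iff
    (hg.measurableSet_lintegral_qpLength_lt_top _)).1 hP.2

theorem agreeOnInvariant_map (hg : IsSelfAvoiding g) {P : Measure ΩX} (hP : P ∈ AMSSource g) :
    AgreeOnInvariant (P.map g) (stationaryTransport g (stationaryMean P)) := fun D hD => by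
  rw [hg.stationaryTransport_of_invariant (hg.ae_lintegral_qpLength_lt_top hP) hD,
    Measure.map_apply hg.measurable hD.1]
  exact agreeOnInvariant_stationaryMean hP.1 _ (hg.measurable_invField hD)

theorem isAMS_map (hg : IsSelfAvoiding g) {P : Measure ΩX} (hP : P ∈ AMSSource g) :
    IsAMS (P.map g) := by
  have := hP.1.1
  have := isProbabilityMeasure_stationaryMean hP.1
  have := hg.isFiniteMeasure_stationaryTransport (hg.ae_lintegral_qpLength_lt_top hP)
  have := Measure.isProbabilityMeasure_map (μ := P) hg.measurable.aemeasurable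
  have hR := hg.measurePreserving_stationaryTransport (measurePreserving_stationaryMean hP.1)
  exact isAMS_of_absolutelyContinuous hR
    (absolutelyContinuous_of_agreeOnInvariant hR (hg.agreeOnInvariant_map hP))

theorem stationaryMean_map (hg : IsSelfAvoiding g) {P : Measure ΩX} (hP : P ∈ AMSSource g) :
    stationaryMean (P.map g) = stationaryTransport g (stationaryMean P) := by
  have := hP.1.1
  have := hg.isFiniteMeasure_stationaryTransport (hg.ae_lintegral_qpLength_lt_top hP)
  have := Measure.isProbabilityMeasure_map (μ := P) hg.measurable.aemeasurable
  exact stationaryMean_eq_of_agreeOnInvariant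
    (hg.measurePreserving_stationaryTransport (measurePreserving_stationaryMean hP.1))
    (hg.agreeOnInvariant_map hP)

/-- Images of invariant functionals have the same law under both stationary means. -/
theorem map_stationaryMean_map (hg : IsSelfAvoiding g) {P : Measure ΩX} (hP : P ∈ AMSSource g)
    {β : Type*} [MeasurableSpace β] {F : ΩY → β} (hF : Measurable[invField ΩY] F) :
    (stationaryMean (P.map g)).map F = (stationaryMean P).map (F ∘ g) := by
  have hFm : Measurable F := hF.mono invField_le le_rfl
  refine Measure.ext fun s hs => ?_
  rw [Measure.map_apply hFm hs, Measure.map_apply (hFm.comp hg.measurable) hs,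
    hg.stationaryMean_map hP, hg.stationaryTransport_of_invariant
      (hg.ae_lintegral_qpLength_lt_top hP) (hF hs), Set.preimage_comp]

/-- Both sides are invariant in `x`, so they need only be compared over sets g⁻¹(D'). There the
right side integrates to the transported measure, and the left side reduces to the target's
conditional measure because each stationary mean agrees with its original measure on invariant
functions. -/
theorem condInv_stationaryMean_map_ae_eq (hg : IsSelfAvoiding g) {P : Measure ΩX}
    (hP : P ∈ AMSSource g) :
    (fun x => condInv (stationaryMean (P.map g)) (g x)) =ᵐ[stationaryMean P]
      fun x => normTransport g (condInv (stationaryMean P) x) := by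
  have hfin := hg.ae_lintegral_qpLength_lt_top hP
  refine ae_eq_of_forall_setLIntegral_apply_eq invField_le (fun x => inferInstance)
    (hfin.mono fun x hx => hg.isProbabilityMeasure_normTransport _ hx)
    (fun C hC => (measurable_condInv_apply _ hC).comp hg.measurable_invField)
    (fun C hC => ((Measure.measurable_coe hC).comp hg.measurable_normTransport).comp
      (measurable_invField_condInv _)) fun C hC D hD => ?_
  obtain ⟨D', hD', rfl⟩ := hg.exists_preimage_eq hD
  rw [hg.setLIntegral_normTransport_condInv _ hC hD', ← hg.stationaryMean_map hP,
    ← setLIntegral_condInv_apply _ hC hD', ← lintegral_indicator hD.1,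
    ← lintegral_indicator hD'.1]
  have hind : Measurable[invField ΩY] (D'.indicator fun y =>
      condInv (stationaryMean (P.map g)) y C) := (measurable_condInv_apply _ hC).indicator hD'
  have hagree := agreeOnInvariant_stationaryMean (hg.isAMS_map hP)
  rw [← hagree.lintegral_eq hind, lintegral_map (hind.mono invField_le le_rfl) hg.measurable]
  exact ((agreeOnInvariant_stationaryMean hP.1).lintegral_eq
    (hind.comp hg.measurable_invField)).symm

theorem prior_stationaryMean_map (hg : IsSelfAvoiding g) {P : Measure ΩX}
    (hP : P ∈ AMSSource g) :
    prior (stationaryMean (P.map g)) = (prior (stationaryMean P)).map (normTransport g) := by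
  rw [prior, hg.map_stationaryMean_map hP (measurable_invField_condInv _), prior,
    Measure.map_map hg.measurable_normTransport (measurable_condInv _)]
  exact Measure.map_congr (hg.condInv_stationaryMean_map_ae_eq hP)

theorem prior_eq_map_normTransportInv (hg : IsSelfAvoiding g) {P : Measure ΩX}
    (hP : P ∈ AMSSource g) :
    prior (stationaryMean P) = (prior (stationaryMean (P.map g))).map (normTransportInv g) := by
  rw [hg.prior_stationaryMean_map hP, prior,
    Measure.map_map hg.measurable_normTransportInv hg.measurable_normTransport,
    Measure.map_map (hg.measurable_normTransportInv.comp hg.measurable_normTransport)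
      (measurable_condInv _)]
  refine Measure.map_congr ?_
  filter_upwards [hg.ae_lintegral_qpLength_lt_top hP] with x hx
  exact (hg.normTransportInv_normTransport _ hx).symm

theorem map_mem_AMSTarget (hg : IsSelfAvoiding g) {P : Measure ΩX} (hP : P ∈ AMSSource g) :
    P.map g ∈ AMSTarget g := by
  refine ⟨hg.isAMS_map hP, ?_⟩
  have he := hg.measurableEmbedding
  have hpos : MeasurableSet[invField ΩY]
      {y | 0 < condInv (stationaryMean (P.map g)) y (Set.range g)} :=
    measurable_condInv_apply _ he.measurableSet_range measurableSet_Ioi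
  have hmeas : MeasurableSet[invField ΩX]
      {x | 0 < condInv (stationaryMean (P.map g)) (g x) (Set.range g)} :=
    hg.measurable_invField hpos
  rw [ae_map_iff hg.measurable.aemeasurable hpos.1]
  rw [(agreeOnInvariant_stationaryMean hP.1).ae_iff hmeas]
  filter_upwards [hg.condInv_stationaryMean_map_ae_eq hP,
    hg.ae_lintegral_qpLength_lt_top hP] with x hx hfin
  -- C_g(f) gives the range mass 1/∫L_g df, positive exactly when the integral is finite.
  rw [hx, hg.normTransport_apply _ he.measurableSet_range, ← Set.image_univ, hg.spread_image]
  simpa using hfin.ne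

theorem mem_AMSSource (hg : IsSelfAvoiding g) {PX : Measure ΩX} {PY : Measure ΩY}
    (hPY : IsAMS PY) (hinv : PlainTransportInv g PX PY) (hrange : PY (Set.range g) = 1) :
    PX ∈ AMSSource g := by
  have he := hg.measurableEmbedding
  have hR := measurePreserving_stationaryMean hPY
  have := hPY.1
  have : IsProbabilityMeasure PX := ⟨by
    rw [hinv _ MeasurableSet.univ, Set.image_univ, hrange]⟩
  -- `Q` is finite but need not be normalized; dominating `PX` is enough to transfer its conditional
  -- measures.
  set Q : Measure ΩX := (stationaryMean PY).comap g with hQ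
  have hQT : MeasurePreserving (shift ΩX) Q Q := hg.measurePreserving_comap hR
  have : IsFiniteMeasure Q := ⟨by
    rw [hQ, he.comap_apply]
    exact measure_lt_top _ _⟩
  have hPQ : PX ≪ Q := Measure.AbsolutelyContinuous.mk fun A hA hA0 => by
    rw [hQ, he.comap_apply] at hA0
    rw [hinv A hA]
    exact absolutelyContinuous_of_agreeOnInvariant hR (agreeOnInvariant_stationaryMean hPY) hA0
  have hPX := isAMS_of_absolutelyContinuous hQT hPQ
  refine ⟨hPX, ?_⟩
  have hL : ∀ᵐ x ∂Q, ∫⁻ x', qpLength g x' ∂(condInv Q x) < ∞ := by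
    refine ae_lt_top ((measurable_lintegral_condInv Q hg.measurable_qpLength).mono
      invField_le le_rfl) ?_
    have h := setLIntegral_lintegral_condInv Q hg.measurable_qpLength
      (@MeasurableSet.univ _ (invField ΩX))
    rw [Measure.restrict_univ] at h
    rw [h]
    exact ((hg.lintegral_qpLength_comap_le hR).trans_lt (measure_lt_top _ _)).ne
  have hac := absolutelyContinuous_of_agreeOnInvariant (measurePreserving_stationaryMean hPX)
    (agreeOnInvariant_stationaryMean hPX)
  filter_upwards [hPQ.ae_le hL, hac.ae_le (condInv_stationaryMean_ae_eq hQT hPQ)] with x hx hxe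
  rwa [hxe]

theorem plainTransport_of_plainTransportInv (hg : IsSelfAvoiding g) {PX : Measure ΩX}
    {PY : Measure ΩY} [IsProbabilityMeasure PY] (hinv : PlainTransportInv g PX PY)
    (hrange : PY (Set.range g) = 1) : PlainTransport g PX PY := fun B hB => by
  rw [hinv _ (hg.measurable hB), Set.image_preimage_eq_inter_range]
  refine (measure_inter_conull ?_).symm
  exact (prob_compl_eq_zero_iff hg.measurableEmbedding.measurableSet_range).2 hrange

theorem plainTransportInv_map (hg : IsSelfAvoiding g) (P : Measure ΩX) :
    PlainTransportInv g P (P.map g) := fun A _ => by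
  rw [hg.measurableEmbedding.map_apply, hg.injective.preimage_image]

theorem mem_AMSSource_and_plainTransport_iff (hg : IsSelfAvoiding g) {PX : Measure ΩX}
    {PY : Measure ΩY} : (PX ∈ AMSSource g ∧ PlainTransport g PX PY) ↔
      (PY ∈ AMSTarget g ∧ PlainTransportInv g PX PY ∧ PY (Set.range g) = 1) := by
  constructor
  · rintro ⟨hPX, hplain⟩
    obtain rfl := hg.plainTransport_iff.1 hplain
    have := hPX.1.1
    refine ⟨hg.map_mem_AMSTarget hPX, hg.plainTransportInv_map PX, ?_⟩
    rw [hg.measurableEmbedding.map_apply, Set.preimage_range, measure_univ]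
  · rintro ⟨hPY, hinv, hrange⟩
    have := hPY.1.1
    exact ⟨hg.mem_AMSSource hPY.1 hinv hrange,
      hg.plainTransport_of_plainTransportInv hinv hrange⟩

end IsSelfAvoiding

theorem lintegral_prior_apply (Q : Measure ΩX) [IsFiniteMeasure Q] {F : Measure ΩX → ℝ≥0∞}
    (hF : Measurable F) : ∫⁻ f, F f ∂(prior Q) = ∫⁻ x, F (condInv Q x) ∂Q :=
  lintegral_map hF (measurable_condInv Q)

theorem eq_lintegral_prior (Q : Measure ΩX) [IsFiniteMeasure Q] {A : Set ΩX}
    (hA : MeasurableSet A) : Q A = ∫⁻ f, f A ∂(prior Q) := by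
  rw [lintegral_prior_apply Q (Measure.measurable_coe hA), lintegral_condInv_apply Q hA]

end Transport

theorem theorem2 {X Y : Type*} [Countable X] [MeasurableSpace X] [MeasurableSingletonClass X]
    [Countable Y] [MeasurableSpace Y] [MeasurableSingletonClass Y]
    (ΩX : InvariantSet X) (ΩY : InvariantSet Y) (g : ΩX → ΩY) (hg : IsSelfAvoiding g)
    (PX : Measure ΩX) (PY : Measure ΩY) :
    ((PX ∈ AMSSource g ∧ PlainTransport g PX PY) ↔
      (PY ∈ AMSTarget g ∧ PlainTransportInv g PX PY ∧ PY (Set.range g) = 1)) ∧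
    ((PX ∈ AMSSource g ∧ PlainTransport g PX PY) →
      -- the priors are linked by `C_g`
      prior (stationaryMean PY) = (prior (stationaryMean PX)).map (normTransport g) ∧
      prior (stationaryMean PX) = (prior (stationaryMean PY)).map (normTransportInv g) ∧
      -- from the stationary mean of `PX` to that of `PY`
      (∀ B : Set ΩY, MeasurableSet B →
        stationaryMean PY B = ∫⁻ f, f B ∂(prior (stationaryMean PY)) ∧
        stationaryMean PY B = ∫⁻ f, normTransport g f B ∂(prior (stationaryMean PX)) ∧
        stationaryMean PY B =
          ∫⁻ f, (∫⁻ x, spread g B x ∂f) / (∫⁻ x, qpLength g x ∂f) ∂(prior (stationaryMean PX)) ∧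
        stationaryMean PY B =
          ∫⁻ x, (∫⁻ x', spread g B x' ∂(condInv (stationaryMean PX) x)) /
            (∫⁻ x', qpLength g x' ∂(condInv (stationaryMean PX) x)) ∂(stationaryMean PX)) ∧
      -- from the stationary mean of `PY` to that of `PX`
      (∀ A : Set ΩX, MeasurableSet A →
        stationaryMean PX A = ∫⁻ f, f A ∂(prior (stationaryMean PX)) ∧
        stationaryMean PX A = ∫⁻ f, normTransportInv g f A ∂(prior (stationaryMean PY)) ∧
        stationaryMean PX A =
          ∫⁻ f, f (g '' A) / f (Set.range g) ∂(prior (stationaryMean PY)) ∧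
        stationaryMean PX A =
          ∫⁻ y, condInv (stationaryMean PY) y (g '' A) /
            condInv (stationaryMean PY) y (Set.range g) ∂(stationaryMean PY))) := by
  refine ⟨hg.mem_AMSSource_and_plainTransport_iff, ?_⟩
  rintro ⟨hPX, hplain⟩
  -- With P_Y the image of P_X, each chain below is the barycentre formula for one prior, rewritten
  -- through the image relation between the priors.
  obtain rfl := hg.plainTransport_iff.1 hplain
  have hY := hg.prior_stationaryMean_map hPX
  have hX := hg.prior_eq_map_normTransportInv hPX
  refine ⟨hY, hX, fun B hB => ?_, fun A hA => ?_⟩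
  · have h1 := eq_lintegral_prior (stationaryMean (PX.map g)) hB
    have hm : Measurable fun f => normTransport g f B :=
      (Measure.measurable_coe hB).comp hg.measurable_normTransport
    have h2 : stationaryMean (PX.map g) B =
        ∫⁻ f, normTransport g f B ∂(prior (stationaryMean PX)) := by
      rw [h1, hY, lintegral_map (Measure.measurable_coe hB) hg.measurable_normTransport]
    have h3 := h2
    have h4 := h2
    rw [lintegral_prior_apply _ hm] at h4
    simp only [hg.normTransport_apply _ hB] at h3 h4
    exact ⟨h1, h2, h3, h4⟩
  · have h1 := eq_lintegral_prior (stationaryMean PX) hA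
    have hm : Measurable fun f => normTransportInv g f A :=
      (Measure.measurable_coe hA).comp hg.measurable_normTransportInv
    have h2 : stationaryMean PX A =
        ∫⁻ f, normTransportInv g f A ∂(prior (stationaryMean (PX.map g))) := by
      rw [h1, hX, lintegral_map (Measure.measurable_coe hA) hg.measurable_normTransportInv]
    have h3 := h2
    have h4 := h2
    rw [lintegral_prior_apply _ hm] at h4
    simp only [hg.normTransportInv_apply] at h3 h4
    exact ⟨h1, h2, h3, h4⟩
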